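/- Let $G=\mathrm{SL}(2,\mathbb R)$, $\Gamma=\mathrm{SL}(2,\mathbb Z)$, $\mathbb T=\mathbb R/\mathbb Z$ and $e(x)=\mathrm e^{2\pi\mathrm i x}$. Write $M\in G$ in Iwasawa coordinates $(u+\mathrm i v,\phi)$, $v>0$, $\phi\in\mathbb R/2\pi\mathbb Z$, $$M=\begin{pmatrix}1&u\\0&1\end{pmatrix}\begin{pmatrix}v^{1/2}&0\\0&v^{-1/2}\end{pmatrix}\begin{pmatrix}\cos\phi&-\sin\phi\\ \sin\phi&\cos\phi\end{pmatrix}.$$ Let $\chi$ be the indicator function of $(0,1]$, and put $\chi_\phi(w)=\chi(w)$ if $\phi=0 \bmod 2\pi$, $\chi_\phi(w)=\chi(-w)$ if $\phi=\pi\bmod 2\pi$, and otherwise $$\chi_\phi(w)=|\sin\phi|^{-1/2}\int_{\mathbb R} e\!\left(\frac{\tfrac12(w^2+w'^2)\cos\phi-ww'}{\sin\phi}\right)\chi(w')\,dw'.$$ Consider the theta series $$\Theta_\chi(M;(x,y))=v^{1/4}\sum_{n\in\mathbb Z}\chi_\phi\big((n-y)v^{1/2}\big)\,e\big(\tfrac12(n-y)^2u+nx\big).$$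 (a) For every $M\in G$ this series converges unconditionally in $L^2([0,1)^2,dx\,dy)$. Let $\nu_M$ be the Borel probability measure on $\mathbb C$ which is the law of $e(t)\,|\Theta_\chi(M;(x,y))|$ for $(t,x,y)$ uniformly distributed in $[0,1)^3$ (a fundamental domain of $\mathbb T^3$). Then $\nu_M$ depends only on the coset $\Gamma M\in\Gamma\backslash G$. (b) With respect to the weak topology on the Borel probability measures on $\mathbb C$ (tested against bounded continuous functions), $$\overline{\{\nu_M: M\in\Gamma\backslash G\}}=\{\nu_M: M\in\Gamma\backslash G\}\cup\{\delta_0\},$$ where $\delta_0$ is the unit point mass at $0$. (c) If $(M_i)_{i\in\mathbb N}$ is a sequence in $\Gamma\backslash G$ that diverges, i.e. for every compact $K\subset\Gamma\backslash G$ there is $i_0$ such that $M_i\notin K$ for all $i\ge i_0$, then $\nu_{M_i}\to\delta_0$ weakly. -/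

import Mathlib

open MeasureTheory Filter Topology
open scoped MatrixGroups

noncomputable section

namespace ThetaLaw

/-- `e(x) = exp(2 π i x)`. -/
def e (x : ℝ) : ℂ := Complex.exp (2 * Real.pi * Complex.I * (x : ℂ))

/-! ### The group `G = SL(2,ℝ)`, the lattice `Γ = SL(2,ℤ)` and Iwasawa coordinates -/

/-- `Γ = SL(2,ℤ)` as a subgroup of `SL(2,ℝ)`. -/
def Gam : Subgroup SL(2, ℝ) :=
  (Matrix.SpecialLinearGroup.map (n := Fin 2) (Int.castRingHom ℝ)).range

/-- The space `Γ \ G` of cosets `Γ M`, with the quotient topology. -/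
abbrev ModQuot : Type := Quotient (QuotientGroup.rightRel Gam)

/-- The projection `G → Γ \ G`, `M ↦ Γ M`. -/
def toQuot (M : SL(2, ℝ)) : ModQuot := Quotient.mk _ M

/-- Iwasawa coordinate `u = Re (M · i)`. -/
def iwU (M : SL(2, ℝ)) : ℝ :=
  (M.1 0 0 * M.1 1 0 + M.1 0 1 * M.1 1 1) / (M.1 1 0 ^ 2 + M.1 1 1 ^ 2)

/-- Iwasawa coordinate `v = Im (M · i)`. -/
def iwV (M : SL(2, ℝ)) : ℝ := 1 / (M.1 1 0 ^ 2 + M.1 1 1 ^ 2)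

/-- Iwasawa coordinate `φ = arg (c i + d)`; only its class modulo `2 π` matters. -/
def iwPhi (M : SL(2, ℝ)) : ℝ := Complex.arg ⟨M.1 1 1, M.1 1 0⟩

theorem row_pos (M : SL(2, ℝ)) : 0 < M.1 1 0 ^ 2 + M.1 1 1 ^ 2 := by
  have h := M.2
  rw [Matrix.det_fin_two] at h
  by_contra hc
  have h0 : M.1 1 0 = 0 := by nlinarith [sq_nonneg (M.1 1 0), sq_nonneg (M.1 1 1)]
  have h1 : M.1 1 1 = 0 := by nlinarith [sq_nonneg (M.1 1 0), sq_nonneg (M.1 1 1)]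
  rw [h0, h1] at h
  norm_num at h

theorem iwV_pos (M : SL(2, ℝ)) : 0 < iwV M := one_div_pos.mpr (row_pos M)

/-- The coordinates above are those of the Iwasawa decomposition. -/
theorem iwasawa (M : SL(2, ℝ)) :
    M.1 = !![1, iwU M; 0, 1] * !![Real.sqrt (iwV M), 0; 0, 1 / Real.sqrt (iwV M)] *
      !![Real.cos (iwPhi M), -Real.sin (iwPhi M); Real.sin (iwPhi M), Real.cos (iwPhi M)] := by
  have hr := row_pos M
  have hdet := M.2
  rw [Matrix.det_fin_two] at hdet
  set r : ℝ := Real.sqrt (M.1 1 0 ^ 2 + M.1 1 1 ^ 2) with hrdef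
  have hr0 : 0 < r := Real.sqrt_pos.mpr hr
  have hr2 : r ^ 2 = M.1 1 0 ^ 2 + M.1 1 1 ^ 2 := Real.sq_sqrt hr.le
  have hv : Real.sqrt (iwV M) = 1 / r := by
    rw [iwV, Real.sqrt_div zero_le_one, Real.sqrt_one]
  have hnorm : ‖(⟨M.1 1 1, M.1 1 0⟩ : ℂ)‖ = r := by
    rw [Complex.norm_def, Complex.normSq_mk, hrdef]
    congr 1
    ring
  have hne : (⟨M.1 1 1, M.1 1 0⟩ : ℂ) ≠ 0 := by
    rw [← norm_pos_iff, hnorm]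
    exact hr0
  have hcos : Real.cos (iwPhi M) = M.1 1 1 / r := by
    rw [iwPhi, Complex.cos_arg hne, hnorm]
  have hsin : Real.sin (iwPhi M) = M.1 1 0 / r := by
    rw [iwPhi, Complex.sin_arg, hnorm]
  rw [hv, hcos, hsin, iwU, ← hr2]
  ext i j
  fin_cases i <;> fin_cases j <;>
    simp [Matrix.mul_apply, Fin.sum_univ_two] <;> field_simp <;>
    first
    | (rw [hr2]; linear_combination (M.1 1 1) * hdet)
    | (rw [hr2]; linear_combination (-(M.1 1 0)) * hdet)

/-! ### The theta function of the indicator function of `(0,1]` -/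

/-- The function `f_φ`. -/
def rot (f : ℝ → ℂ) (φ : ℝ) (w : ℝ) : ℂ :=
  open Classical in
  if (φ : Real.Angle) = 0 then f w
  else if (φ : Real.Angle) = (Real.pi : Real.Angle) then f (-w)
  else ((|Real.sin φ| ^ (-(1 / 2) : ℝ) : ℝ) : ℂ) *
    ∫ w' : ℝ, e (((1 / 2) * (w ^ 2 + w' ^ 2) * Real.cos φ - w * w') / Real.sin φ) * f w'

/-- The `n`-th term of the series `Θ_f(τ,φ;(x,y))`, as a function of `p = (x,y)`, where
`(τ,φ)`, `τ = u + i v`, are the Iwasawa coordinates of `M`. -/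
def thetaTerm (f : ℝ → ℂ) (M : SL(2, ℝ)) (n : ℤ) (p : ℝ × ℝ) : ℂ :=
  ((iwV M ^ (1 / 4 : ℝ) : ℝ) : ℂ) * rot f (iwPhi M) ((n - p.2) * Real.sqrt (iwV M)) *
    e ((1 / 2) * (n - p.2) ^ 2 * iwU M + n * p.1)

/-- The indicator function of `(0,1]`. -/
def chi : ℝ → ℂ := (Set.Ioc (0 : ℝ) 1).indicator fun _ => 1

/-- Lebesgue measure on the fundamental domain `[0,1)` of `𝕋 = ℝ/ℤ`. -/
def unif : Measure ℝ := volume.restrict (Set.Ico 0 1)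

instance : IsProbabilityMeasure unif := ⟨by simp [unif]⟩

theorem continuous_e : Continuous e := by
  unfold e
  fun_prop

theorem norm_e (x : ℝ) : ‖e x‖ = 1 := by
  rw [e, show 2 * (Real.pi : ℂ) * Complex.I * (x : ℂ) = ((2 * Real.pi * x : ℝ) : ℂ) * Complex.I by
    push_cast; ring]
  exact Complex.norm_exp_ofReal_mul_I _

theorem measurable_chi : Measurable chi :=
  measurable_const.indicator measurableSet_Ioc

theorem norm_chi_le (w : ℝ) : ‖chi w‖ ≤ 1 := by
  unfold chi
  by_cases h : w ∈ Set.Ioc (0 : ℝ) 1 <;> simp [h]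

theorem integral_norm_chi : ∫ w, ‖chi w‖ = 1 := by
  have : (fun w => ‖chi w‖) = (Set.Ioc (0 : ℝ) 1).indicator fun _ => (1 : ℝ) := by
    ext w
    by_cases h : w ∈ Set.Ioc (0 : ℝ) 1 <;> simp [chi, h]
  rw [this, integral_indicator measurableSet_Ioc]
  simp

theorem measurable_rot_chi (φ : ℝ) : Measurable (rot chi φ) := by
  by_cases h0 : (φ : Real.Angle) = 0
  · have : rot chi φ = chi := by ext w; simp [rot, h0]
    rw [this]
    exact measurable_chi
  by_cases h1 : (φ : Real.Angle) = (Real.pi : Real.Angle)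
  · have : rot chi φ = fun w => chi (-w) := by
      ext w; rw [rot, if_neg h0, if_pos h1]
    rw [this]
    exact measurable_chi.comp measurable_neg
  have : rot chi φ = fun w => ((|Real.sin φ| ^ (-(1 / 2) : ℝ) : ℝ) : ℂ) *
    ∫ w' : ℝ, e (((1 / 2) * (w ^ 2 + w' ^ 2) * Real.cos φ - w * w') / Real.sin φ) * chi w' := by
      ext w; simp only [rot, h0, h1, if_false]
  rw [this]
  refine Measurable.const_mul ?_ _
  refine StronglyMeasurable.measurable (StronglyMeasurable.integral_prod_right' (f := fun z : ℝ × ℝ =>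
    e (((1 / 2) * (z.1 ^ 2 + z.2 ^ 2) * Real.cos φ - z.1 * z.2) / Real.sin φ) * chi z.2) ?_)
  refine Measurable.stronglyMeasurable ?_
  refine Measurable.mul (continuous_e.measurable.comp ?_) (measurable_chi.comp measurable_snd)
  fun_prop

theorem exists_bound_rot_chi (φ : ℝ) : ∃ C : ℝ, ∀ w, ‖rot chi φ w‖ ≤ C := by
  refine ⟨max 1 ((|Real.sin φ| ^ (-(1 / 2) : ℝ) : ℝ)), fun w => ?_⟩
  unfold rot
  split_ifs
  · exact (norm_chi_le w).trans (le_max_left _ _)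
  · exact (norm_chi_le (-w)).trans (le_max_left _ _)
  · refine le_trans ?_ (le_max_right _ _)
    have hs : 0 ≤ |Real.sin φ| ^ (-(1 / 2) : ℝ) := Real.rpow_nonneg (abs_nonneg _) _
    rw [norm_mul, Complex.norm_real, Real.norm_of_nonneg hs]
    refine mul_le_of_le_one_right hs ((norm_integral_le_integral_norm _).trans ?_)
    simp only [norm_mul, norm_e, one_mul]
    exact integral_norm_chi.le

/-- Each term of the theta series of `chi` is square integrable in `(x,y)`. -/
theorem memLp_thetaTerm (M : SL(2, ℝ)) (n : ℤ) :
    MemLp (thetaTerm chi M n) 2 (unif.prod unif) := by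
  obtain ⟨C, hC⟩ := exists_bound_rot_chi (iwPhi M)
  refine MemLp.of_bound (C := iwV M ^ (1 / 4 : ℝ) * C) ?_ (Eventually.of_forall fun p => ?_)
  · refine Measurable.aestronglyMeasurable ?_
    unfold thetaTerm
    refine Measurable.mul (Measurable.const_mul ((measurable_rot_chi _).comp ?_) _)
      (continuous_e.measurable.comp ?_)
    · fun_prop
    · fun_prop
  · have hv : 0 ≤ iwV M ^ (1 / 4 : ℝ) := Real.rpow_nonneg (iwV_pos M).le _
    rw [thetaTerm, norm_mul, norm_mul, norm_e, mul_one, Complex.norm_real, Real.norm_of_nonneg hv]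
    exact mul_le_mul_of_nonneg_left (hC _) hv

/-- The `n`-th term of the theta series of `chi`, as an element of `L²(𝕋²)`. -/
def thetaTermLp (M : SL(2, ℝ)) (n : ℤ) : Lp ℂ 2 (unif.prod unif) :=
  (memLp_thetaTerm M n).toLp _

/-- `Θ_χ(M; ·)`, the sum of the theta series of `chi` in `L²(𝕋²)`. -/
def theta (M : SL(2, ℝ)) : Lp ℂ 2 (unif.prod unif) := ∑' n : ℤ, thetaTermLp M n

/-! ### The probability measures `ν_M` -/

/-- The random variable `e(t) |Θ_χ(M; ξ)|` on `𝕋³ ∋ (t, ξ)`. -/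
def thetaVar (M : SL(2, ℝ)) (z : ℝ × ℝ × ℝ) : ℂ := e z.1 * ((‖theta M z.2‖ : ℝ) : ℂ)

theorem aemeasurable_thetaVar (M : SL(2, ℝ)) :
    AEMeasurable (thetaVar M) (unif.prod (unif.prod unif)) := by
  refine Measurable.aemeasurable ?_
  unfold thetaVar
  refine Measurable.mul (continuous_e.measurable.comp measurable_fst) ?_
  exact Complex.measurable_ofReal.comp
    (((Lp.stronglyMeasurable (theta M)).measurable.comp measurable_snd).norm)

/-- `ν_M`: the law of `e(t) |Θ_χ(M; ξ)|` for `(t, ξ)` uniformly distributed in `𝕋³`. -/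
def nuG (M : SL(2, ℝ)) : ProbabilityMeasure ℂ :=
  ⟨(unif.prod (unif.prod unif)).map (thetaVar M),
    Measure.isProbabilityMeasure_map (aemeasurable_thetaVar M)⟩

/-- The point mass at `0`. -/
def delta0 : ProbabilityMeasure ℂ := ⟨Measure.dirac 0, inferInstance⟩

end ThetaLaw

end

/-!
`Θ_χ(M; ·)` is the Zak transform of `weil M`, which is, up to a phase, the image of `χ` under the
operator of `M` in the Weil representation. The Zak transform is an isometry from `L²(ℝ)` into
`L²(𝕋²)`, which gives convergence of the series. The generator `T` of `Γ` acts on `L²(ℝ)` by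
multiplication by a chirp, which the Zak transform turns into an affine shear of the torus, and `S`
acts by the Fourier transform, which Poisson summation turns into a quarter turn of the torus. These
maps of the torus preserve Lebesgue measure and the factors of modulus one disappear in `|Θ_χ|`, so
`ν_M` is `Γ`-invariant.

The map `M ↦ weil M` into `L²(ℝ)` is continuous where the lower left entry of `M` is nonzero; as
left multiplication by `S` moves all other points there, `ν_M` is continuous in `M`. As `v → ∞`, the
`L²`-mass of `weil M` concentrates near `0`, so `Θ_χ(M; (x, y))` is small unless `y` is close to an
integer, and `ν_M → δ₀`. By reduction theory every divergent sequence in `Γ \ G` has representatives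
with `v → ∞`. Thus `ν` extends continuously to the one-point compactification of `Γ \ G` with value
`δ₀` at infinity, and the image of a compact space is closed.
-/

noncomputable section

namespace ThetaLaw

open scoped ENNReal FourierTransform SchwartzMap

/-! ### Characters of the real line -/

theorem e_add (x y : ℝ) : e (x + y) = e x * e y := by
  rw [e, e, e, ← Complex.exp_add]
  push_cast
  ring_nf

theorem e_intCast (n : ℤ) : e n = 1 := by
  rw [e, Complex.exp_eq_one_iff]
  exact ⟨n, by push_cast; ring⟩

theorem e_zero : e 0 = 1 := by simpa using e_intCast 0

theorem e_add_intCast (x : ℝ) (n : ℤ) : e (x + n) = e x := by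
  rw [e_add, e_intCast, mul_one]

theorem e_intCast_mul_fract (n : ℤ) (x : ℝ) : e (n * Int.fract x) = e (n * x) := by
  rw [Int.fract, ← e_add_intCast _ (n * ⌊x⌋)]
  congr 1
  push_cast
  ring

theorem conj_e (x : ℝ) : starRingEnd ℂ (e x) = e (-x) := by
  rw [e, e, ← Complex.exp_conj]
  simp [map_ofNat]

theorem memLp_mul_e {α : Type*} [MeasurableSpace α] {μ : Measure α} {f : α → ℂ} {p : ℝ≥0∞}
    (hf : MemLp f p μ) {θ : α → ℝ} (hθ : Measurable θ) : MemLp (fun x => f x * e (θ x)) p μ :=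
  hf.of_le (hf.1.mul (continuous_e.measurable.comp hθ).aestronglyMeasurable) <|
    .of_forall fun x => by rw [norm_mul, norm_e, mul_one]

theorem hasDerivAt_e_comp {θ : ℝ → ℝ} {θ' t : ℝ} (h : HasDerivAt θ θ' t) :
    HasDerivAt (fun t => e (θ t)) (e (θ t) * (2 * Real.pi * Complex.I * θ')) t :=
  (h.ofReal_comp.const_mul (2 * Real.pi * Complex.I)).cexp

theorem restrict_Ioc_eq_unif : volume.restrict (Set.Ioc (0 : ℝ) 1) = unif :=
  Measure.restrict_congr_set Ico_ae_eq_Ioc.symm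

theorem integral_e_intCast_mul {k : ℤ} (hk : k ≠ 0) : ∫ x, e (k * x) ∂unif = 0 := by
  have hc : 2 * Real.pi * Complex.I * k ≠ 0 := by simp [Real.pi_ne_zero, hk]
  have h : ∀ x : ℝ, e (k * x) = Complex.exp (2 * Real.pi * Complex.I * k * x) := fun x => by
    rw [e]; push_cast; ring_nf
  have h1 : Complex.exp (2 * Real.pi * Complex.I * k) = 1 := by simpa using (h 1).symm.trans (by
    simpa using e_intCast k)
  simp only [h, ← restrict_Ioc_eq_unif, ← intervalIntegral.integral_of_le zero_le_one,
    integral_exp_mul_complex hc]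
  simp [h1]

/-! ### The law of a randomly rotated modulus -/

section Law

variable {Ω Ω' E E' : Type*} [MeasurableSpace Ω] [MeasurableSpace Ω']
  [NormedAddCommGroup E] [NormedAddCommGroup E'] {μ : Measure Ω} {μ' : Measure Ω'} {p q : ℝ≥0∞}

/-- The random variable `e(t) ‖F(ξ)‖`, with `t` uniform in `[0,1)` and independent of `ξ`. -/
def lawVar (F : Lp E p μ) (z : ℝ × Ω) : ℂ := e z.1 * ((‖F z.2‖ : ℝ) : ℂ)

theorem measurable_lawVar (F : Lp E p μ) : Measurable (lawVar F) := by
  unfold lawVar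
  exact (continuous_e.measurable.comp measurable_fst).mul <| Complex.measurable_ofReal.comp <|
    (Lp.stronglyMeasurable F).norm.measurable.comp measurable_snd

theorem edist_lawVar_le (F G : Lp E p μ) (z : ℝ × Ω) :
    edist (lawVar F z) (lawVar G z) ≤ edist (F z.2) (G z.2) := by
  rw [edist_dist, edist_dist]
  refine ENNReal.ofReal_le_ofReal ?_
  rw [lawVar, lawVar, dist_eq_norm, ← mul_sub, norm_mul, norm_e, one_mul, ← Complex.ofReal_sub,
    Complex.norm_real, dist_eq_norm]
  exact abs_norm_sub_norm_le _ _

variable [IsProbabilityMeasure μ] [IsProbabilityMeasure μ']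

/-- The law of `e(t) ‖F(ξ)‖`; for `F = Θ_χ(M; ·)` it is `ν_M`. -/
def law (F : Lp E p μ) : ProbabilityMeasure ℂ :=
  ⟨(unif.prod μ).map (lawVar F),
    Measure.isProbabilityMeasure_map (measurable_lawVar F).aemeasurable⟩

theorem tendsto_law_of_tendstoInMeasure {ι : Type*} {l : Filter ι} [l.IsCountablyGenerated]
    [l.NeBot] {F : ι → Lp E p μ} {G : Lp E p μ} (h : TendstoInMeasure μ (fun i => ⇑(F i)) l G) :
    Tendsto (fun i => law (F i)) l (𝓝 (law G)) := by
  have hvar : TendstoInMeasure (unif.prod μ) (fun i => lawVar (F i)) l (lawVar G) := by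
    intro ε hε
    refine tendsto_of_tendsto_of_tendsto_of_le_of_le tendsto_const_nhds (h ε hε)
      (fun _ => zero_le) fun i => ?_
    have hm : MeasurableSet {x | ε ≤ edist (F i x) (G x)} := measurableSet_le measurable_const
      ((Lp.stronglyMeasurable (F i)).edist (Lp.stronglyMeasurable G)).measurable
    calc (unif.prod μ) {z | ε ≤ edist (lawVar (F i) z) (lawVar G z)}
        ≤ (unif.prod μ) (Prod.snd ⁻¹' {x | ε ≤ edist (F i x) (G x)}) :=
          measure_mono fun z hz => le_trans (Set.mem_ofPred.mp hz) (edist_lawVar_le _ _ z)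
      _ = _ := measurePreserving_snd.measure_preimage hm.nullMeasurableSet
  exact (hvar.tendstoInDistribution fun i => (measurable_lawVar _).aemeasurable).tendsto

theorem continuous_law [Fact (1 ≤ p)] : Continuous (law : Lp E p μ → ProbabilityMeasure ℂ) :=
  continuous_iff_continuousAt.mpr fun _ =>
    tendsto_law_of_tendstoInMeasure (tendstoInMeasure_of_tendsto_Lp tendsto_id)

theorem law_eq_of_norm_eq {F : Lp E p μ} {G : Lp E' q μ'} {φ : Ω' → Ω}
    (hφ : MeasurePreserving φ μ' μ) (h : ∀ᵐ x ∂μ', ‖G x‖ = ‖F (φ x)‖) : law G = law F := by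
  refine Subtype.ext ?_
  change (unif.prod μ').map (lawVar G) = (unif.prod μ).map (lawVar F)
  have hmp := (MeasurePreserving.id unif).prod hφ
  rw [← hmp.map_eq, Measure.map_map (measurable_lawVar F) hmp.measurable]
  refine Measure.map_congr ?_
  filter_upwards [Measure.quasiMeasurePreserving_snd.ae h] with z hz
  simp only [lawVar, Function.comp, Prod.map, id, hz]

theorem law_smul {𝕜 : Type*} [NormedField 𝕜] [NormedSpace 𝕜 E] {c : 𝕜} (hc : ‖c‖ = 1)
    (F : Lp E p μ) : law (c • F) = law F := by
  refine law_eq_of_norm_eq (MeasurePreserving.id _) ?_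
  filter_upwards [Lp.coeFn_smul c F] with x hx
  rw [hx, Pi.smul_apply, norm_smul, hc, one_mul, id]

theorem law_zero : law (0 : Lp E p μ) = delta0 := by
  refine Subtype.ext ?_
  change (unif.prod μ).map (lawVar 0) = Measure.dirac 0
  have h0 : lawVar (0 : Lp E p μ) =ᵐ[unif.prod μ] fun _ => 0 := by
    filter_upwards [Measure.quasiMeasurePreserving_snd.ae (Lp.coeFn_zero E p μ)] with z hz
    rw [lawVar, hz, Pi.zero_apply, norm_zero, Complex.ofReal_zero, mul_zero]
  rw [Measure.map_congr h0, Measure.map_const, measure_univ, one_smul]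

end Law

/-! ### The Zak transform -/

theorem norm_toLp_sq {α E : Type*} [MeasurableSpace α] [NormedAddCommGroup E] {μ : Measure α}
    {f : α → E} (hf : MemLp f 2 μ) : ‖hf.toLp f‖ ^ 2 = ∫ x, ‖f x‖ ^ 2 ∂μ := by
  have h0 : 0 ≤ ∫ x, ‖f x‖ ^ 2 ∂μ := integral_nonneg fun _ => sq_nonneg _
  rw [Lp.norm_toLp, hf.eLpNorm_eq_integral_rpow_norm two_ne_zero ENNReal.ofNat_ne_top,
    ENNReal.toReal_ofReal (by positivity)]
  simp only [ENNReal.toReal_ofNat, Real.rpow_ofNat, ← Real.sqrt_eq_rpow, ← one_div]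
  exact Real.sq_sqrt h0

/-- The `n`-th term of the Zak transform of `g`. -/
def zakTerm (g : ℝ → ℂ) (n : ℤ) (p : ℝ × ℝ) : ℂ := g (n - p.2) * e (n * p.1)

theorem norm_zakTerm (g : ℝ → ℂ) (n : ℤ) (p : ℝ × ℝ) : ‖zakTerm g n p‖ = ‖g (n - p.2)‖ := by
  rw [zakTerm, norm_mul, norm_e, mul_one]

theorem measurePreserving_intCast_sub_snd (n : ℤ) :
    MeasurePreserving (fun p : ℝ × ℝ => n - p.2) (unif.prod unif)
      (volume.restrict (Set.Ioc (-1 + n : ℝ) (-1 + n + 1))) := by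
  have h := (Measure.measurePreserving_sub_left volume (n : ℝ)).restrict_preimage
    (measurableSet_Ioc (a := (-1 + n : ℝ)) (b := -1 + n + 1))
  have hpre : (fun y : ℝ => n - y) ⁻¹' Set.Ioc (-1 + n : ℝ) (-1 + n + 1) = Set.Ico 0 1 := by
    ext y
    simp only [Set.mem_preimage, Set.mem_Ioc, Set.mem_Ico]
    constructor <;> rintro ⟨h1, h2⟩ <;> constructor <;> linarith
  rw [hpre] at h
  exact h.comp measurePreserving_snd

theorem zakTerm_congr_ae {g h : ℝ → ℂ} (hgh : g =ᵐ[volume] h) (n : ℤ) :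
    zakTerm g n =ᵐ[unif.prod unif] zakTerm h n := by
  filter_upwards [(measurePreserving_intCast_sub_snd n).quasiMeasurePreserving.ae
    (ae_restrict_of_ae hgh)] with p hp
  rw [zakTerm, hp, zakTerm]

theorem memLp_zakTerm {g : ℝ → ℂ} {p : ℝ≥0∞} (hg : MemLp g p) (n : ℤ) :
    MemLp (zakTerm g n) p (unif.prod unif) := by
  have h := hg.restrict (Set.Ioc (-1 + n : ℝ) (-1 + n + 1)) |>.comp_measurePreserving
    (measurePreserving_intCast_sub_snd n)
  exact memLp_mul_e h (by fun_prop)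

/-- The `n`-th term of the Zak transform, as a linear map between spaces of square integrable
functions. -/
def zakTermₗ (n : ℤ) : Lp ℂ 2 (volume : Measure ℝ) →ₗ[ℂ] Lp ℂ 2 (unif.prod unif) where
  toFun f := (memLp_zakTerm (Lp.memLp f) n).toLp _
  map_add' f g := by
    rw [← MemLp.toLp_add, MemLp.toLp_eq_toLp_iff]
    refine (zakTerm_congr_ae (Lp.coeFn_add f g) n).trans (.of_forall fun p => ?_)
    simp only [zakTerm, Pi.add_apply, add_mul]
  map_smul' c f := by
    rw [RingHom.id_apply, ← MemLp.toLp_const_smul, MemLp.toLp_eq_toLp_iff]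
    refine (zakTerm_congr_ae (Lp.coeFn_smul c f) n).trans (.of_forall fun p => ?_)
    simp only [zakTerm, Pi.smul_apply, smul_mul_assoc]

theorem zakTermₗ_toLp {g : ℝ → ℂ} (hg : MemLp g 2) (n : ℤ) :
    zakTermₗ n (hg.toLp g) = (memLp_zakTerm hg n).toLp _ :=
  MemLp.toLp_congr (memLp_zakTerm (Lp.memLp _) n) _ (zakTerm_congr_ae hg.coeFn_toLp n)

theorem coeFn_zakTermₗ (n : ℤ) (f : Lp ℂ 2 (volume : Measure ℝ)) :
    zakTermₗ n f =ᵐ[unif.prod unif] zakTerm f n :=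
  (memLp_zakTerm (Lp.memLp f) n).coeFn_toLp

theorem hasSum_norm_zakTermₗ_sq (f : Lp ℂ 2 (volume : Measure ℝ)) :
    HasSum (fun n => ‖zakTermₗ n f‖ ^ 2) (‖f‖ ^ 2) := by
  have hterm (n : ℤ) : ‖zakTermₗ n f‖ ^ 2 = ∫ w in (-1 + n : ℝ)..(-1 + n + 1), ‖f w‖ ^ 2 := by
    have hmp := measurePreserving_intCast_sub_snd n
    have hf : AEStronglyMeasurable (fun w => ‖f w‖ ^ 2)
        (volume.restrict (Set.Ioc (-1 + n : ℝ) (-1 + n + 1))) :=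
      ((Lp.stronglyMeasurable f).norm.pow 2).aestronglyMeasurable
    rw [intervalIntegral.integral_of_le (by linarith), ← hmp.map_eq,
      integral_map hmp.measurable.aemeasurable (by rwa [hmp.map_eq])]
    simp only [zakTermₗ, LinearMap.coe_mk, AddHom.coe_mk, norm_toLp_sq, norm_zakTerm]
  have hf : ‖f‖ ^ 2 = ∫ w, ‖f w‖ ^ 2 := by
    rw [← norm_toLp_sq (Lp.memLp f), Lp.toLp_coeFn]
  simpa only [hterm, hf] using (Lp.memLp f).integrable_norm_pow two_ne_zero
    |>.hasSum_intervalIntegral (-1)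

theorem inner_zakTermₗ_eq_zero (f : Lp ℂ 2 (volume : Measure ℝ)) {m n : ℤ} (hmn : m ≠ n) :
    inner ℂ (zakTermₗ m f) (zakTermₗ n f) = 0 := by
  have hprod : inner ℂ (zakTermₗ m f) (zakTermₗ n f) = ∫ p : ℝ × ℝ, e ((n - m : ℤ) * p.1) *
      (f (n - p.2) * starRingEnd ℂ (f (m - p.2))) ∂(unif.prod unif) := by
    rw [L2.inner_def]
    refine integral_congr_ae ?_
    filter_upwards [coeFn_zakTermₗ m f, coeFn_zakTermₗ n f] with p hm hn
    have he : e ((n - m : ℤ) * p.1) = e (n * p.1) * e (-(m * p.1)) := by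
      rw [← e_add]
      congr 1
      push_cast
      ring
    rw [hm, hn, RCLike.inner_apply, zakTerm, zakTerm, map_mul, conj_e, he]
    ring
  rw [hprod, integral_prod_mul (fun x => e ((n - m : ℤ) * x))
    (fun y => f (n - y) * starRingEnd ℂ (f (m - y))),
    integral_e_intCast_mul (sub_ne_zero.mpr hmn.symm), zero_mul]

theorem orthogonalFamily_span_zakTermₗ (f : Lp ℂ 2 (volume : Measure ℝ)) :
    OrthogonalFamily ℂ (fun n => Submodule.span ℂ {zakTermₗ n f})
      fun n => (Submodule.span ℂ {zakTermₗ n f}).subtypeₗᵢ :=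
  OrthogonalFamily.of_pairwise fun _ _ hmn => Submodule.isOrtho_span.mpr <| by
    rintro _ rfl _ rfl
    exact inner_zakTermₗ_eq_zero f hmn

theorem summable_zakTermₗ (f : Lp ℂ 2 (volume : Measure ℝ)) :
    Summable fun n => zakTermₗ n f :=
  (orthogonalFamily_span_zakTermₗ f).summable_iff_norm_sq_summable
    (fun _ => ⟨_, Submodule.mem_span_singleton_self _⟩) |>.mpr (hasSum_norm_zakTermₗ_sq f).summable

/-- The Zak transform `g ↦ ∑ₙ g(n - y) e(n x)`, an isometry from `L²(ℝ)` into `L²(𝕋²)`. -/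
def zak : Lp ℂ 2 (volume : Measure ℝ) →ₗᵢ[ℂ] Lp ℂ 2 (unif.prod unif) where
  toFun f := ∑' n, zakTermₗ n f
  map_add' f g := by
    simp only [map_add]
    exact (summable_zakTermₗ f).tsum_add (summable_zakTermₗ g)
  map_smul' c f := by
    simp only [map_smul, RingHom.id_apply]
    exact (summable_zakTermₗ f).tsum_const_smul c
  norm_map' f := by
    have hsum := (summable_zakTermₗ f).hasSum.norm.pow 2
    have hpyth : ∀ s : Finset ℤ, ‖∑ n ∈ s, zakTermₗ n f‖ ^ 2 = ∑ n ∈ s, ‖zakTermₗ n f‖ ^ 2 :=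
      (orthogonalFamily_span_zakTermₗ f).norm_sum
        fun _ => ⟨_, Submodule.mem_span_singleton_self _⟩
    simp only [hpyth] at hsum
    exact (sq_eq_sq₀ (norm_nonneg _) (norm_nonneg _)).mp
      (tendsto_nhds_unique hsum (hasSum_norm_zakTermₗ_sq f))

theorem hasSum_zak (f : Lp ℂ 2 (volume : Measure ℝ)) :
    HasSum (fun n => zakTermₗ n f) (zak f) :=
  (summable_zakTermₗ f).hasSum

theorem zak_toLp_eq_of_hasSum {g : ℝ → ℂ} (hg : MemLp g 2) {F : ℝ × ℝ → ℂ} {A : Set (ℝ × ℝ)}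
    (h : ∀ᵐ p ∂(unif.prod unif), p ∈ A → HasSum (fun n => zakTerm g n p) (F p)) :
    ∀ᵐ p ∂(unif.prod unif), p ∈ A → zak (hg.toLp g) p = F p := by
  obtain ⟨s, hs, hlim⟩ := (tendstoInMeasure_of_tendsto_Lp
    (hasSum_zak (hg.toLp g))).exists_seq_tendsto_ae'
  have hterm : ∀ᵐ p ∂(unif.prod unif), ∀ n, zakTermₗ n (hg.toLp g) p = zakTerm g n p :=
    ae_all_iff.mpr fun n => by
      rw [zakTermₗ_toLp hg]
      exact MemLp.coeFn_toLp _
  have hsum : ∀ᵐ p ∂(unif.prod unif), ∀ k,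
      (∑ n ∈ s k, zakTermₗ n (hg.toLp g) : Lp ℂ 2 (unif.prod unif)) p =
        ∑ n ∈ s k, zakTermₗ n (hg.toLp g) p :=
    ae_all_iff.mpr fun k => Lp.coeFn_fun_finsetSum _ _
  filter_upwards [hlim, hterm, hsum, h] with p hp hterm hsum hF hpA
  simp only [hsum, hterm] at hp
  exact tendsto_nhds_unique hp ((hF hpA).comp hs)

/-! ### Measure preserving maps of the torus -/

theorem measurePreserving_fract (c : ℝ) :
    MeasurePreserving Int.fract (volume.restrict (Set.Ioc c (c + 1))) unif := by
  refine ⟨measurable_fract, Measure.ext_of_lintegral _ fun F hF => ?_⟩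
  have hper : Function.Periodic (fun x : ℝ => F (Int.fract x)) 1 := fun x => by
    simp only [Int.fract_add_one]
  have h (a : ℝ) := AddCircle.lintegral_preimage 1 a hper.lift
  simp only [Function.Periodic.lift_coe] at h
  rw [lintegral_map hF measurable_fract, h, ← h 0, zero_add, restrict_Ioc_eq_unif, unif]
  refine setLIntegral_congr_fun measurableSet_Ico fun x hx => ?_
  rw [Int.fract_eq_self.mpr hx]

theorem measurePreserving_fract_add (c : ℝ) :
    MeasurePreserving (fun x => Int.fract (x + c)) unif unif := by
  have h := (measurePreserving_add_right volume c).restrict_preimage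
    (measurableSet_Ioc (a := c) (b := c + 1))
  rw [Set.preimage_add_const_Ioc, sub_self, add_sub_cancel_left, restrict_Ioc_eq_unif] at h
  exact (measurePreserving_fract c).comp h

/-- The action of `((1,1),(0,1))` on the torus, as an affine map: the shift by `1/2` comes from
`n² ≡ n` modulo `2`. -/
def shear (p : ℝ × ℝ) : ℝ × ℝ := (Int.fract (p.1 + (1 / 2 - p.2)), p.2)

/-- The action of `((0,-1),(1,0))` on the torus; as `1 - x` lies in `(0,1]`, the fundamental domain
`[0,1)²` is only preserved up to a null set. -/
def quarterTurn (p : ℝ × ℝ) : ℝ × ℝ := (p.2, 1 - p.1)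

theorem measurePreserving_shear :
    MeasurePreserving shear (unif.prod unif) (unif.prod unif) := by
  have h := (MeasurePreserving.id unif).skew_product (μc := unif) (μd := unif)
    (g := fun y x => Int.fract (x + (1 / 2 - y))) (by unfold Function.uncurry; fun_prop)
    (.of_forall fun y => (measurePreserving_fract_add _).map_eq)
  exact (Measure.measurePreserving_swap.comp h).comp Measure.measurePreserving_swap

theorem measurePreserving_quarterTurn :
    MeasurePreserving quarterTurn (unif.prod unif) (unif.prod unif) := by
  have h := (Measure.measurePreserving_sub_left volume (1 : ℝ)).restrict_preimage
    (measurableSet_Ioc (a := (0 : ℝ)) (b := 1))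
  rw [Set.preimage_const_sub_Ioc, sub_self, sub_zero, restrict_Ioc_eq_unif, ← unif] at h
  exact ((MeasurePreserving.id unif).prod h).comp Measure.measurePreserving_swap

theorem law_zak_eq_of_zakTerm_eq {f g : ℝ → ℂ} (hf : MemLp f 2) (hg : MemLp g 2)
    {φ : ℝ × ℝ → ℝ × ℝ} (hφ : MeasurePreserving φ (unif.prod unif) (unif.prod unif))
    {c : ℝ × ℝ → ℂ} (hc : ∀ p, ‖c p‖ = 1) (h : ∀ n p, zakTerm g n p = c p * zakTerm f n (φ p)) :
    law (zak (hg.toLp g)) = law (zak (hf.toLp f)) := by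
  have hsum {k : ℝ → ℂ} (hk : MemLp k 2) (s : Finset ℤ) :
      (∑ n ∈ s, zakTermₗ n (hk.toLp k) : Lp ℂ 2 (unif.prod unif)) =ᵐ[unif.prod unif]
        fun p => ∑ n ∈ s, zakTerm k n p := by
    simp only [zakTermₗ_toLp hk]
    filter_upwards [Lp.coeFn_fun_finsetSum s fun n => (memLp_zakTerm hk n).toLp _,
      ae_all_iff.mpr fun n => (memLp_zakTerm hk n).coeFn_toLp] with p hp hterm
    simp only [hp, hterm]
  have hlaw (s : Finset ℤ) : law (∑ n ∈ s, zakTermₗ n (hg.toLp g)) =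
      law (∑ n ∈ s, zakTermₗ n (hf.toLp f)) := by
    refine law_eq_of_norm_eq hφ ?_
    filter_upwards [hsum hg s, hφ.quasiMeasurePreserving.ae (hsum hf s)] with p hp hp'
    rw [hp, hp']
    simp only [h, ← Finset.mul_sum, norm_mul, hc, one_mul]
  have hlim (F : Lp ℂ 2 (volume : Measure ℝ)) :=
    (continuous_law.tendsto (zak F)).comp (hasSum_zak F)
  refine tendsto_nhds_unique (hlim _) ((hlim _).congr fun s => ?_)
  exact (hlaw s).symm

theorem zakTerm_chirp (f : ℝ → ℂ) (n : ℤ) (p : ℝ × ℝ) :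
    zakTerm (fun w => e ((1 / 2) * w ^ 2) * f w) n p =
      e ((1 / 2) * p.2 ^ 2) * zakTerm f n (shear p) := by
  obtain ⟨k, hk⟩ : ∃ k : ℤ, (n : ℝ) ^ 2 - n = 2 * k := by
    obtain ⟨k, hk⟩ := Int.even_mul_pred_self n
    have : (n : ℝ) * (n - 1) = k + k := by exact_mod_cast hk
    exact ⟨k, by linarith⟩
  have hphase : e ((1 / 2) * (n - p.2) ^ 2) * e (n * p.1) =
      e ((1 / 2) * p.2 ^ 2) * e (n * (p.1 + (1 / 2 - p.2))) := by
    rw [← e_add, ← e_add, ← e_add_intCast ((1 / 2) * p.2 ^ 2 + n * (p.1 + (1 / 2 - p.2))) k]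
    congr 1
    linear_combination hk / 2
  simp only [zakTerm, shear, e_intCast_mul_fract]
  linear_combination f (n - p.2) * hphase

theorem law_zak_chirp {f : ℝ → ℂ} (hf : MemLp f 2)
    (hg : MemLp (fun w => e ((1 / 2) * w ^ 2) * f w) 2) :
    law (zak (hg.toLp _)) = law (zak (hf.toLp f)) :=
  law_zak_eq_of_zakTerm_eq hf hg measurePreserving_shear (fun _ => norm_e _) (zakTerm_chirp f)

/-! ### Poisson summation -/

theorem fourier_mul_e (f : ℝ → ℂ) (y ξ : ℝ) : 𝓕 (fun t => f t * e (t * y)) ξ = 𝓕 f (ξ - y) := by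
  simp only [Real.fourier_real_eq_integral_exp_smul, smul_eq_mul]
  congr 1 with t
  rw [e, mul_left_comm, ← Complex.exp_add, mul_comm]
  congr 2
  push_cast
  ring

theorem summable_schwartzMap_intCast_sub (f : 𝓢(ℝ, ℂ)) (y : ℝ) : Summable fun n : ℤ => f (n - y) :=
  summable_of_isBigO (Real.summable_abs_int_rpow one_lt_two) <|
    ((SchwartzMap.compSubConstCLM ℝ y f).isBigO_cocompact_rpow (-2)).comp_tendsto
      Int.tendsto_coe_cofinite

theorem summable_zakTerm_schwartzMap (f : 𝓢(ℝ, ℂ)) (p : ℝ × ℝ) :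
    Summable fun n => zakTerm f n p :=
  .of_norm <| by simpa only [norm_zakTerm] using (summable_schwartzMap_intCast_sub f p.2).norm

theorem tsum_zakTerm_fourier (f : 𝓢(ℝ, ℂ)) (p : ℝ × ℝ) :
    ∑' n, zakTerm (𝓕 f : 𝓢(ℝ, ℂ)) n p =
      e ((p.1 - 1) * p.2) * ∑' n, zakTerm f n (quarterTurn p) := by
  have hcont : Continuous fun t => f t * e (t * p.2) :=
    f.continuous.mul (continuous_e.comp (by fun_prop))
  have hdecay : (fun t => f t * e (t * p.2)) =O[cocompact ℝ] fun t => |t| ^ (-2 : ℝ) :=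
    (Asymptotics.isBigO_of_le _ fun t => by rw [norm_mul, norm_e, mul_one]).trans
      (f.isBigO_cocompact_rpow (-2))
  have hpoisson := Real.tsum_eq_tsum_fourier_of_rpow_decay_of_summable hcont one_lt_two hdecay
    (by simpa only [fourier_mul_e, SchwartzMap.fourier_coe] using
      summable_schwartzMap_intCast_sub (𝓕 f) p.2) p.1
  have hchar (n : ℤ) : fourier n (p.1 : UnitAddCircle) = e (n * p.1) := by
    rw [fourier_coe_apply, e]
    push_cast
    ring_nf
  simp only [fourier_mul_e, hchar] at hpoisson
  rw [← tsum_mul_left, ← (Equiv.addRight (1 : ℤ)).tsum_eq fun n => e _ * zakTerm f n _]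
  refine hpoisson.symm.trans (tsum_congr fun n => ?_)
  have harg : ((n + 1 : ℤ) : ℝ) - (1 - p.1) = p.1 + n := by push_cast; ring
  rw [Equiv.coe_addRight, zakTerm, quarterTurn, harg, mul_left_comm, ← e_add]
  congr 2
  push_cast
  ring

theorem zak_schwartzMap_ae_eq (f : 𝓢(ℝ, ℂ)) :
    zak (f.toLp 2) =ᵐ[unif.prod unif] fun p => ∑' n, zakTerm f n p := by
  have h := zak_toLp_eq_of_hasSum (f.memLp 2) (A := Set.univ)
    (.of_forall fun p _ => (summable_zakTerm_schwartzMap f p).hasSum)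
  filter_upwards [h] with p hp using hp (Set.mem_univ p)

theorem law_zak_fourier (f : Lp ℂ 2 (volume : Measure ℝ)) : law (zak (𝓕 f)) = law (zak f) := by
  have hlaw : Continuous fun f => law (zak f) := continuous_law.comp zak.continuous
  refine DenseRange.induction_on (SchwartzMap.denseRange_toLpCLM (p := 2) ENNReal.ofNat_ne_top) f
    (isClosed_eq (hlaw.comp (FourierTransform.fourierCLM ℂ (Lp ℂ 2 volume)).continuous) hlaw)
    fun f => ?_
  rw [SchwartzMap.toLpCLM_apply, SchwartzMap.toLp_fourier_eq]
  refine law_eq_of_norm_eq measurePreserving_quarterTurn ?_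
  filter_upwards [zak_schwartzMap_ae_eq (𝓕 f),
    measurePreserving_quarterTurn.quasiMeasurePreserving.ae (zak_schwartzMap_ae_eq f)] with p hp hp'
  rw [hp, hp', tsum_zakTerm_fourier, norm_mul, norm_e, one_mul]

/-! ### Oscillatory integrals -/

theorem integral_e_eq_sub {θ θ' θ'' : ℝ → ℝ} {a b : ℝ}
    (hθ : ∀ t ∈ Set.uIcc a b, HasDerivAt θ (θ' t) t)
    (hθ' : ∀ t ∈ Set.uIcc a b, HasDerivAt θ' (θ'' t) t) (hcont : ContinuousOn θ'' (Set.uIcc a b))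
    (hne : ∀ t ∈ Set.uIcc a b, θ' t ≠ 0) :
    2 * Real.pi * Complex.I * ∫ t in a..b, e (θ t) =
      e (θ b) / θ' b - e (θ a) / θ' a + ∫ t in a..b, e (θ t) * (θ'' t / θ' t ^ 2) := by
  have hne' : ∀ t ∈ Set.uIcc a b, (θ' t : ℂ) ≠ 0 := fun t ht =>
    Complex.ofReal_ne_zero.mpr (hne t ht)
  have hcθ : ContinuousOn θ (Set.uIcc a b) := HasDerivAt.continuousOn hθ
  have hcθ' : ContinuousOn θ' (Set.uIcc a b) := HasDerivAt.continuousOn hθ'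
  have hparts := intervalIntegral.integral_mul_deriv_eq_deriv_mul (a := a) (b := b)
    (u := fun t => (θ' t : ℂ)⁻¹) (u' := fun t => -(θ'' t : ℂ) / (θ' t : ℂ) ^ 2)
    (v := fun t => e (θ t)) (v' := fun t => e (θ t) * (2 * Real.pi * Complex.I * θ' t))
    (fun t ht => (hθ' t ht).ofReal_comp.inv (hne' t ht))
    (fun t ht => hasDerivAt_e_comp (hθ t ht))
    (ContinuousOn.intervalIntegrable (.div (by fun_prop) (by fun_prop) fun t ht =>
      pow_ne_zero 2 (hne' t ht)))
    (ContinuousOn.intervalIntegrable (.mul (continuous_e.comp_continuousOn hcθ) (by fun_prop)))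
  have hleft : ∫ t in a..b, (θ' t : ℂ)⁻¹ * (e (θ t) * (2 * Real.pi * Complex.I * θ' t)) =
      2 * Real.pi * Complex.I * ∫ t in a..b, e (θ t) := by
    rw [← intervalIntegral.integral_const_mul]
    refine intervalIntegral.integral_congr fun t ht => ?_
    have := hne' t ht
    field_simp
  rw [← hleft, hparts, sub_eq_add_neg _ (∫ t in a..b, _), ← intervalIntegral.integral_neg]
  congr 1
  · ring
  · congr 1 with t
    ring

theorem norm_integral_e_le {θ θ' θ'' : ℝ → ℝ} {a b δ C : ℝ} (hab : a ≤ b) (hδ : 0 < δ)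
    (hθ : ∀ t ∈ Set.Icc a b, HasDerivAt θ (θ' t) t)
    (hθ' : ∀ t ∈ Set.Icc a b, HasDerivAt θ' (θ'' t) t) (hcont : ContinuousOn θ'' (Set.Icc a b))
    (hlower : ∀ t ∈ Set.Icc a b, δ ≤ |θ' t|) (hupper : ∀ t ∈ Set.Icc a b, |θ'' t| ≤ C) :
    2 * Real.pi * ‖∫ t in a..b, e (θ t)‖ ≤ 2 / δ + (b - a) * C / δ ^ 2 := by
  rw [← Set.uIcc_of_le hab] at hθ hθ' hcont hlower hupper
  have hpos : ∀ t ∈ Set.uIcc a b, 0 < |θ' t| := fun t ht => hδ.trans_le (hlower t ht)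
  have hboundary : ∀ t ∈ Set.uIcc a b, ‖e (θ t) / θ' t‖ ≤ 1 / δ := fun t ht => by
    rw [norm_div, norm_e, Complex.norm_real, Real.norm_eq_abs]
    exact one_div_le_one_div_of_le hδ (hlower t ht)
  have hinterior : ‖∫ t in a..b, e (θ t) * (θ'' t / θ' t ^ 2)‖ ≤ C / δ ^ 2 * |b - a| := by
    refine intervalIntegral.norm_integral_le_of_norm_le_const fun t ht => ?_
    have ht := Set.uIoc_subset_uIcc ht
    rw [norm_mul, norm_e, one_mul, norm_div, norm_pow, Complex.norm_real, Complex.norm_real,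
      Real.norm_eq_abs, Real.norm_eq_abs]
    exact div_le_div₀ ((abs_nonneg _).trans (hupper t ht)) (hupper t ht) (by positivity)
      (pow_le_pow_left₀ hδ.le (hlower t ht) 2)
  calc 2 * Real.pi * ‖∫ t in a..b, e (θ t)‖
      = ‖2 * Real.pi * Complex.I * ∫ t in a..b, e (θ t)‖ := by simp [abs_of_pos Real.pi_pos]
    _ ≤ 1 / δ + 1 / δ + C / δ ^ 2 * |b - a| := by
      rw [integral_e_eq_sub hθ hθ' hcont fun t ht => abs_pos.mp (hpos t ht)]
      exact norm_add_le_of_le (norm_sub_le_of_le (hboundary b Set.right_mem_uIcc)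
        (hboundary a Set.left_mem_uIcc)) hinterior
    _ = 2 / δ + (b - a) * C / δ ^ 2 := by
      rw [abs_of_nonneg (sub_nonneg.mpr hab)]
      ring

/-- The incomplete Fresnel integral over `[0,1]`. -/
def fresnel (α β : ℝ) : ℂ := ∫ t in (0 : ℝ)..1, e ((1 / 2) * α * t ^ 2 - β * t)

theorem continuous_fresnel : Continuous fun p : ℝ × ℝ => fresnel p.1 p.2 :=
  intervalIntegral.continuous_parametric_intervalIntegral_of_continuous'
    (f := fun (p : ℝ × ℝ) t => e ((1 / 2) * p.1 * t ^ 2 - p.2 * t))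
    (continuous_e.comp (by fun_prop)) 0 1

theorem norm_fresnel_le_one (α β : ℝ) : ‖fresnel α β‖ ≤ 1 := by
  have h := intervalIntegral.norm_integral_le_of_norm_le_const (a := 0) (b := 1)
    fun t _ => (norm_e ((1 / 2) * α * t ^ 2 - β * t)).le
  rwa [sub_zero, abs_one, mul_one] at h

theorem norm_fresnel_le_one_div {α β : ℝ} (hβ : β ≠ 0) (h : 2 * |α| ≤ |β|) :
    ‖fresnel α β‖ ≤ 1 / |β| := by
  have : 0 < |β| := abs_pos.mpr hβ
  have hbound := norm_integral_e_le (θ := fun t => (1 / 2) * α * t ^ 2 - β * t)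
    (θ' := fun t => α * t - β) (θ'' := fun _ => α) (δ := |β| / 2) (C := |β| / 2)
    zero_le_one (by positivity)
    (fun t _ => by
      refine (((hasDerivAt_pow 2 t).const_mul ((1 / 2) * α)).sub
        ((hasDerivAt_id t).const_mul β)).congr_deriv ?_
      push_cast
      ring)
    (fun t _ => by simpa using ((hasDerivAt_id t).const_mul α).sub_const β)
    continuousOn_const
    (fun t ht => by
      have h1 : |α * t| ≤ |α| := by
        rw [abs_mul, abs_of_nonneg ht.1]
        exact mul_le_of_le_one_right (abs_nonneg α) ht.2
      have h2 := abs_sub_abs_le_abs_sub β (α * t)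
      rw [abs_sub_comm] at h2
      linarith)
    (fun t _ => by linarith)
  have hsum : 2 / (|β| / 2) + (1 - 0) * (|β| / 2) / (|β| / 2) ^ 2 = 6 * (1 / |β|) := by
    field_simp
    norm_num
  rw [hsum, ← fresnel] at hbound
  nlinarith [Real.pi_gt_three, norm_nonneg (fresnel α β)]

/-! ### The Weil representation applied to the indicator function -/

/-- The image of `χ` under the operator of `((a,b),(c,d))`, `c ≠ 0`, in the Weil representation,
up to a phase; `b` is determined by the other entries. -/
def weilBigCell (a c d w : ℝ) : ℂ :=
  ((|c| ^ (-(1 / 2) : ℝ) : ℝ) : ℂ) * e ((1 / 2) * a * w ^ 2 / c) * fresnel (d / c) (w / c)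

theorem norm_weilBigCell_sq (a c d w : ℝ) :
    ‖weilBigCell a c d w‖ ^ 2 = |c|⁻¹ * ‖fresnel (d / c) (w / c)‖ ^ 2 := by
  have h : (|c| ^ (-(1 / 2) : ℝ)) ^ 2 = |c|⁻¹ := by
    rw [← Real.rpow_natCast, ← Real.rpow_mul (abs_nonneg c)]
    norm_num [Real.rpow_neg_one]
  rw [weilBigCell, norm_mul, norm_mul, norm_e, mul_one, mul_pow, Complex.norm_real,
    Real.norm_of_nonneg (by positivity), h]

theorem norm_weilBigCell_sq_le_inv (a c d w : ℝ) : ‖weilBigCell a c d w‖ ^ 2 ≤ |c|⁻¹ := by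
  rw [norm_weilBigCell_sq]
  exact mul_le_of_le_one_right (by positivity)
    (pow_le_one₀ (norm_nonneg _) (norm_fresnel_le_one _ _))

theorem norm_weilBigCell_sq_le_div {a c d w : ℝ} (hc : c ≠ 0) (hw : w ≠ 0) (h : 2 * |d| ≤ |w|) :
    ‖weilBigCell a c d w‖ ^ 2 ≤ |c| / w ^ 2 := by
  have hc' : 0 < |c| := abs_pos.mpr hc
  have hfresnel : ‖fresnel (d / c) (w / c)‖ ≤ |c| / |w| := by
    refine (norm_fresnel_le_one_div (div_ne_zero hw hc) ?_).trans_eq (by rw [abs_div, one_div_div])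
    rw [abs_div, abs_div, ← mul_div_assoc]
    exact div_le_div_of_nonneg_right h hc'.le
  calc ‖weilBigCell a c d w‖ ^ 2 ≤ |c|⁻¹ * (|c| / |w|) ^ 2 := by
        rw [norm_weilBigCell_sq]
        gcongr
    _ = |c| / w ^ 2 := by
      rw [div_pow, sq_abs w]
      field_simp

theorem norm_weilBigCell_sq_le {a c d δ A : ℝ} (hA : 1 ≤ A) (hδ : 0 < δ) (hδc : δ ≤ |c|)
    (hcA : |c| ≤ A) (hdA : |d| ≤ A) (w : ℝ) :
    ‖weilBigCell a c d w‖ ^ 2 ≤ (2 * A + (1 + 4 * A ^ 2) / δ) * (1 + w ^ 2)⁻¹ := by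
  rw [← div_eq_mul_inv, le_div_iff₀ (by positivity)]
  rcases le_or_gt (2 * A) |w| with hw | hw
  · have hw2 : 1 ≤ w ^ 2 := by
      rw [← sq_abs]
      nlinarith
    have htail := norm_weilBigCell_sq_le_div (a := a) (abs_pos.mp (hδ.trans_le hδc))
      (abs_pos.mp (by linarith : 0 < |w|)) (by linarith : 2 * |d| ≤ |w|)
    rw [le_div_iff₀ (by positivity)] at htail
    have hdouble : ‖weilBigCell a c d w‖ ^ 2 * (1 + w ^ 2) ≤
        2 * (‖weilBigCell a c d w‖ ^ 2 * w ^ 2) := by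
      nlinarith [sq_nonneg ‖weilBigCell a c d w‖]
    have : 0 ≤ (1 + 4 * A ^ 2) / δ := by positivity
    linarith
  · have hinv : |c|⁻¹ ≤ δ⁻¹ := inv_anti₀ hδ hδc
    have hw2 : 1 + w ^ 2 ≤ 1 + 4 * A ^ 2 := by
      rw [← sq_abs]
      nlinarith [abs_nonneg w]
    calc ‖weilBigCell a c d w‖ ^ 2 * (1 + w ^ 2) ≤ δ⁻¹ * (1 + 4 * A ^ 2) := by
          gcongr
          exact (norm_weilBigCell_sq_le_inv a c d w).trans hinv
      _ = (1 + 4 * A ^ 2) / δ := by ring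
      _ ≤ _ := by linarith

theorem continuous_weilBigCell (a c d : ℝ) : Continuous (weilBigCell a c d) := by
  have hfresnel : Continuous fun w => fresnel (d / c) (w / c) :=
    continuous_fresnel.comp (f := fun w => (d / c, w / c)) (by fun_prop)
  have he : Continuous fun w : ℝ => e ((1 / 2) * a * w ^ 2 / c) := continuous_e.comp (by fun_prop)
  exact (continuous_const.mul he).mul hfresnel

theorem continuousAt_weilBigCell {a c d : ℝ} (hc : c ≠ 0) (w : ℝ) :
    ContinuousAt (fun p : ℝ × ℝ × ℝ => weilBigCell p.1 p.2.1 p.2.2 w) (a, c, d) := by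
  have hc' : ((a, c, d) : ℝ × ℝ × ℝ).2.1 ≠ 0 := hc
  have hfresnel : ContinuousAt (fun p : ℝ × ℝ × ℝ => fresnel (p.2.2 / p.2.1) (w / p.2.1))
      (a, c, d) :=
    continuous_fresnel.continuousAt.comp (f := fun p : ℝ × ℝ × ℝ => (p.2.2 / p.2.1, w / p.2.1))
      (by fun_prop (disch := assumption))
  have he : ContinuousAt (fun p : ℝ × ℝ × ℝ => e ((1 / 2) * p.1 * w ^ 2 / p.2.1)) (a, c, d) :=
    continuous_e.continuousAt.comp (by fun_prop (disch := assumption))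
  have hpow : ContinuousAt (fun p : ℝ × ℝ × ℝ => ((|p.2.1| ^ (-(1 / 2) : ℝ) : ℝ) : ℂ)) (a, c, d) :=
    Complex.continuous_ofReal.continuousAt.comp
      (ContinuousAt.rpow_const (by fun_prop) (Or.inl (abs_ne_zero.mpr hc)))
  exact (hpow.mul he).mul hfresnel

theorem memLp_two_of_norm_sq_le {E : Type*} [NormedAddCommGroup E] {f : ℝ → E}
    (hf : AEStronglyMeasurable f) {C : ℝ} (h : ∀ w, ‖f w‖ ^ 2 ≤ C * (1 + w ^ 2)⁻¹) : MemLp f 2 := by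
  rw [memLp_two_iff_integrable_sq_norm hf]
  refine (integrable_inv_one_add_sq.const_mul C).mono' (hf.norm.pow 2) (.of_forall fun w => ?_)
  rw [Real.norm_of_nonneg (sq_nonneg _)]
  exact h w

theorem memLp_weilBigCell {a c d : ℝ} (hc : c ≠ 0) : MemLp (weilBigCell a c d) 2 :=
  memLp_two_of_norm_sq_le (continuous_weilBigCell a c d).aestronglyMeasurable <|
    norm_weilBigCell_sq_le (A := 1 + |c| + |d|) (by linarith [abs_nonneg c, abs_nonneg d])
      (abs_pos.mpr hc) le_rfl (by linarith [abs_nonneg d]) (by linarith [abs_nonneg c])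

/-- The image of `χ` under the operator of `((a,b),(0,a⁻¹))` in the Weil representation, up to a
phase. -/
def weilBorel (a b w : ℝ) : ℂ :=
  ((|a| ^ (1 / 2 : ℝ) : ℝ) : ℂ) * chi (a * w) * e ((1 / 2) * (a * b) * w ^ 2)

theorem memLp_chi_mul_left {a : ℝ} (ha : a ≠ 0) (p : ℝ≥0∞) : MemLp (fun w => chi (a * w)) p := by
  refine memLp_indicator_const p (measurable_const_mul a measurableSet_Ioc) 1 (.inr ?_)
  rw [Real.volume_preimage_mul_left ha, Real.volume_Ioc]
  exact ENNReal.mul_ne_top ENNReal.ofReal_ne_top ENNReal.ofReal_ne_top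

theorem memLp_weilBorel {a : ℝ} (ha : a ≠ 0) (b : ℝ) (p : ℝ≥0∞) : MemLp (weilBorel a b) p :=
  memLp_mul_e ((memLp_chi_mul_left ha p).const_mul _) (by fun_prop)

/-- The image of `χ` under the operator of `M` in the Weil representation, up to a phase; its Zak
transform is `Θ_χ(M; ·)`. -/
def weil (M : SL(2, ℝ)) (w : ℝ) : ℂ :=
  ((iwV M ^ (1 / 4 : ℝ) : ℝ) : ℂ) * rot chi (iwPhi M) (w * Real.sqrt (iwV M)) *
    e ((1 / 2) * w ^ 2 * iwU M)

theorem thetaTerm_chi (M : SL(2, ℝ)) (n : ℤ) : thetaTerm chi M n = zakTerm (weil M) n := by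
  ext p
  rw [thetaTerm, zakTerm, weil, e_add]
  ring

section Iwasawa

variable (M : SL(2, ℝ))

theorem det_eq_one : M.1 0 0 * M.1 1 1 - M.1 0 1 * M.1 1 0 = 1 := by
  rw [← Matrix.det_fin_two]
  exact M.2

theorem norm_bottomRow :
    ‖(⟨M.1 1 1, M.1 1 0⟩ : ℂ)‖ = Real.sqrt (M.1 1 0 ^ 2 + M.1 1 1 ^ 2) := by
  rw [Complex.norm_def, Complex.normSq_mk]
  congr 1
  ring

theorem bottomRow_ne_zero : (⟨M.1 1 1, M.1 1 0⟩ : ℂ) ≠ 0 := by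
  rw [← norm_pos_iff, norm_bottomRow]
  exact Real.sqrt_pos.mpr (row_pos M)

theorem cos_iwPhi : Real.cos (iwPhi M) = M.1 1 1 * Real.sqrt (iwV M) := by
  rw [iwPhi, Complex.cos_arg (bottomRow_ne_zero M), norm_bottomRow, iwV,
    Real.sqrt_div zero_le_one, Real.sqrt_one, mul_one_div]

theorem sin_iwPhi : Real.sin (iwPhi M) = M.1 1 0 * Real.sqrt (iwV M) := by
  rw [iwPhi, Complex.sin_arg, norm_bottomRow, iwV, Real.sqrt_div zero_le_one, Real.sqrt_one,
    mul_one_div]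

end Iwasawa

theorem iwV_rpow_mul_sin_rpow (M : SL(2, ℝ)) :
    iwV M ^ (1 / 4 : ℝ) * |Real.sin (iwPhi M)| ^ (-(1 / 2) : ℝ) =
      |M.1 1 0| ^ (-(1 / 2) : ℝ) := by
  have hv := iwV_pos M
  rw [sin_iwPhi, abs_mul, abs_of_nonneg (Real.sqrt_nonneg _),
    Real.mul_rpow (abs_nonneg _) (Real.sqrt_nonneg _), Real.sqrt_eq_rpow, ← Real.rpow_mul hv.le,
    mul_left_comm, ← Real.rpow_add hv]
  norm_num

theorem weil_phase_eq {M : SL(2, ℝ)} (hc : M.1 1 0 ≠ 0) (w t : ℝ) :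
    ((1 / 2) * ((w * Real.sqrt (iwV M)) ^ 2 + t ^ 2) * Real.cos (iwPhi M) -
        w * Real.sqrt (iwV M) * t) / Real.sin (iwPhi M) + (1 / 2) * w ^ 2 * iwU M =
      (1 / 2) * M.1 0 0 * w ^ 2 / M.1 1 0 +
        ((1 / 2) * (M.1 1 1 / M.1 1 0) * t ^ 2 - w / M.1 1 0 * t) := by
  have := row_pos M
  have : 0 < Real.sqrt (iwV M) := Real.sqrt_pos.mpr (iwV_pos M)
  rw [sin_iwPhi, cos_iwPhi, mul_pow, Real.sq_sqrt (iwV_pos M).le, iwU]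
  field_simp
  rw [iwV]
  field_simp
  linear_combination -w ^ 2 * M.1 1 1 * det_eq_one M

theorem weil_eq_weilBigCell {M : SL(2, ℝ)} (hc : M.1 1 0 ≠ 0) (w : ℝ) :
    weil M w = weilBigCell (M.1 0 0) (M.1 1 0) (M.1 1 1) w := by
  have hsin : Real.sin (iwPhi M) ≠ 0 := by
    rw [sin_iwPhi]
    exact mul_ne_zero hc (Real.sqrt_pos.mpr (iwV_pos M)).ne'
  have hangle : (iwPhi M : Real.Angle) ≠ 0 ∧ (iwPhi M : Real.Angle) ≠ (Real.pi : Real.Angle) := by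
    rwa [← not_or, ← Real.Angle.sin_eq_zero_iff, Real.Angle.sin_coe]
  have hint : (∫ t : ℝ, e (((1 / 2) * ((w * Real.sqrt (iwV M)) ^ 2 + t ^ 2) * Real.cos (iwPhi M) -
      w * Real.sqrt (iwV M) * t) / Real.sin (iwPhi M)) * chi t) * e ((1 / 2) * w ^ 2 * iwU M) =
      e ((1 / 2) * M.1 0 0 * w ^ 2 / M.1 1 0) * fresnel (M.1 1 1 / M.1 1 0) (w / M.1 1 0) := by
    rw [fresnel, ← integral_mul_const, ← intervalIntegral.integral_const_mul,
      intervalIntegral.integral_of_le zero_le_one, ← integral_indicator measurableSet_Ioc]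
    congr 1 with t
    by_cases ht : t ∈ Set.Ioc (0 : ℝ) 1
    · rw [chi, Set.indicator_of_mem ht, Set.indicator_of_mem ht, mul_one, ← e_add, ← e_add,
        weil_phase_eq hc]
    · rw [chi, Set.indicator_of_notMem ht, Set.indicator_of_notMem ht, mul_zero, zero_mul]
  rw [weil, rot, if_neg hangle.1, if_neg hangle.2, weilBigCell, mul_assoc _ (e _), ← hint,
    ← iwV_rpow_mul_sin_rpow]
  push_cast
  ring

theorem rot_chi_iwPhi_of_eq_zero {M : SL(2, ℝ)} (hc : M.1 1 0 = 0) (w : ℝ) :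
    rot chi (iwPhi M) (w * |M.1 0 0|) = chi (M.1 0 0 * w) := by
  have hdet := det_eq_one M
  rw [hc, mul_zero, sub_zero] at hdet
  have hd : M.1 1 1 = (M.1 0 0)⁻¹ := eq_inv_of_mul_eq_one_right hdet
  rcases lt_or_gt_of_ne (left_ne_zero_of_mul_eq_one hdet) with ha | ha
  · have hphi : iwPhi M = Real.pi := by
      rw [iwPhi, Complex.arg_eq_pi_iff]
      exact ⟨by rw [hd]; exact inv_lt_zero.mpr ha, hc⟩
    rw [rot, hphi, if_neg Real.Angle.pi_ne_zero, if_pos rfl, abs_of_neg ha]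
    congr 1
    ring
  · have hphi : iwPhi M = 0 := by
      rw [iwPhi, Complex.arg_eq_zero_iff]
      exact ⟨by rw [hd]; exact (inv_pos.mpr ha).le, hc⟩
    rw [rot, hphi, if_pos Real.Angle.coe_zero, abs_of_pos ha, mul_comm]

theorem weil_eq_weilBorel {M : SL(2, ℝ)} (hc : M.1 1 0 = 0) (w : ℝ) :
    weil M w = weilBorel (M.1 0 0) (M.1 0 1) w := by
  have hdet := det_eq_one M
  rw [hc, mul_zero, sub_zero] at hdet
  have ha : M.1 0 0 ≠ 0 := left_ne_zero_of_mul_eq_one hdet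
  have hd : M.1 1 1 = (M.1 0 0)⁻¹ := eq_inv_of_mul_eq_one_right hdet
  have hv : iwV M = M.1 0 0 ^ 2 := by
    rw [iwV, hc, hd]
    simp
  have hu : iwU M = M.1 0 0 * M.1 0 1 := by
    rw [iwU, hc, hd]
    field_simp
    ring
  have hpow : (M.1 0 0 ^ 2) ^ (1 / 4 : ℝ) = |M.1 0 0| ^ (1 / 2 : ℝ) := by
    rw [← sq_abs, ← Real.rpow_natCast, ← Real.rpow_mul (abs_nonneg _)]
    norm_num
  rw [weil, hv, Real.sqrt_sq_eq_abs, rot_chi_iwPhi_of_eq_zero hc, hpow, hu, weilBorel]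
  congr 2
  ring

theorem memLp_weil (M : SL(2, ℝ)) : MemLp (weil M) 2 := by
  rcases eq_or_ne (M.1 1 0) 0 with hc | hc
  · have ha : M.1 0 0 ≠ 0 := fun ha => by simpa [ha, hc] using det_eq_one M
    rw [funext (weil_eq_weilBorel hc)]
    exact memLp_weilBorel ha _ 2
  · rw [funext (weil_eq_weilBigCell hc)]
    exact memLp_weilBigCell hc

/-- `weil M` as an element of `L²(ℝ)`. -/
def weilLp (M : SL(2, ℝ)) : Lp ℂ 2 (volume : Measure ℝ) := (memLp_weil M).toLp _

theorem thetaTermLp_eq_zakTermₗ (M : SL(2, ℝ)) (n : ℤ) :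
    thetaTermLp M n = zakTermₗ n (weilLp M) := by
  rw [weilLp, zakTermₗ_toLp]
  exact MemLp.toLp_congr _ _ (.of_eq (thetaTerm_chi M n))

theorem theta_eq_zak (M : SL(2, ℝ)) : theta M = zak (weilLp M) :=
  tsum_congr (thetaTermLp_eq_zakTermₗ M)

theorem nuG_eq_law (M : SL(2, ℝ)) : nuG M = law (zak (weilLp M)) := by
  rw [← theta_eq_zak]
  rfl

/-! ### Fourier transforms of chirps -/

theorem fourier_toLp_eq {V F : Type*} [NormedAddCommGroup V] [InnerProductSpace ℝ V]
    [FiniteDimensional ℝ V] [MeasurableSpace V] [BorelSpace V] [NormedAddCommGroup F]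
    [InnerProductSpace ℂ F] [CompleteSpace F] {f g : V → F} (hf : MemLp f 2) (hg : MemLp g 2)
    (h : ∀ φ : 𝓢(V, ℂ), ∫ x, 𝓕 φ x • f x = ∫ x, φ x • g x) :
    𝓕 (hf.toLp f) = hg.toLp g := by
  refine LinearMap.ker_eq_bot.mp (Lp.ker_toTemperedDistributionCLM_eq_bot (μ := volume)) ?_
  change Lp.toTemperedDistribution (𝓕 (hf.toLp f)) = Lp.toTemperedDistribution (hg.toLp g)
  rw [← Lp.fourier_toTemperedDistribution_eq]
  ext φ
  rw [TemperedDistribution.fourier_apply, Lp.toTemperedDistribution_apply,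
    Lp.toTemperedDistribution_apply]
  calc ∫ x, 𝓕 φ x • hf.toLp f x = ∫ x, 𝓕 φ x • f x :=
        integral_congr_ae (hf.coeFn_toLp.mono fun x hx => by simp only [hx])
    _ = ∫ x, φ x • g x := h φ
    _ = ∫ x, φ x • hg.toLp g x :=
        integral_congr_ae (hg.coeFn_toLp.mono fun x hx => by simp only [hx])

theorem integral_fourier_comp_mul_left {f g : ℝ → ℂ} (hf : Integrable f) (hg : Integrable g)
    (r : ℝ) : ∫ ξ, 𝓕 f (r * ξ) * g ξ = ∫ x, f x * 𝓕 g (r * x) := by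
  have h := VectorFourier.integral_fourierIntegral_smul_eq_flip (μ := volume) (ν := volume)
    (L := r • LinearMap.mul ℝ ℝ) Real.continuous_fourierChar
    (by simp only [LinearMap.smul_apply, LinearMap.mul_apply']; fun_prop) hf hg
  simp only [VectorFourier.fourierIntegral, LinearMap.flip_apply, LinearMap.smul_apply,
    LinearMap.mul_apply', smul_eq_mul] at h
  simp only [Real.fourier_real_eq, mul_left_comm _ r, h]
  simp only [mul_comm]

theorem integral_fourier_mul_gaussian {f : ℝ → ℂ} (hf : Integrable f) {b : ℂ} (hb : 0 < b.re)
    (c : ℂ) : ∫ w, 𝓕 f w * Complex.exp (-Real.pi * b * w ^ 2 + 2 * Real.pi * c * w) =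
      1 / b ^ (1 / 2 : ℂ) * ∫ x, f x * Complex.exp (-Real.pi / b * (x + Complex.I * c) ^ 2) := by
  have hgauss : Integrable fun w : ℝ =>
      Complex.exp (-Real.pi * b * w ^ 2 + 2 * Real.pi * c * w) := by
    have h : (-Real.pi * b).re < 0 := by
      simpa only [neg_mul, Complex.neg_re, Complex.re_ofReal_mul, neg_lt_zero]
        using mul_pos Real.pi_pos hb
    simpa using integrable_cexp_quadratic' h (2 * Real.pi * c) 0
  have hself := integral_fourier_comp_mul_left hf hgauss 1
  simp only [one_mul] at hself
  rw [hself, fourier_gaussian_pi' hb, ← integral_const_mul]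
  congr 1 with x
  ring

theorem tendsto_integral_mul_of_norm_le_one {ι : Type*} {l : Filter ι} [l.IsCountablyGenerated]
    {f : ℝ → ℂ} (hf : Integrable f) {g : ι → ℝ → ℂ} {g₀ : ℝ → ℂ} (hg : ∀ i, Continuous (g i))
    (hg1 : ∀ᶠ i in l, ∀ x, ‖g i x‖ ≤ 1) (hlim : ∀ x, Tendsto (fun i => g i x) l (𝓝 (g₀ x))) :
    Tendsto (fun i => ∫ x, f x * g i x) l (𝓝 (∫ x, f x * g₀ x)) := by
  refine tendsto_integral_filter_of_dominated_convergence (fun x => ‖f x‖)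
    (.of_forall fun i => hf.1.mul (hg i).aestronglyMeasurable) ?_ hf.norm
    (.of_forall fun x => (hlim x).const_mul _)
  filter_upwards [hg1] with i hi
  refine .of_forall fun x => ?_
  rw [norm_mul]
  exact mul_le_of_le_one_right (norm_nonneg _) (hi x)

theorem norm_cexp_neg_pi_mul_sq_le_one {b : ℂ} (hb : 0 ≤ b.re) (x ξ : ℝ) :
    ‖Complex.exp (-Real.pi * b * x ^ 2 + 2 * Real.pi * (-(Complex.I * ξ)) * x)‖ ≤ 1 := by
  rw [Complex.norm_exp, Real.exp_le_one_iff]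
  have h : (-Real.pi * b * x ^ 2 + 2 * Real.pi * (-(Complex.I * ξ)) * x : ℂ).re =
      -(Real.pi * b.re * x ^ 2) := by
    simp [pow_two]
  rw [h, neg_nonpos]
  have := Real.pi_pos
  positivity

theorem norm_cexp_neg_pi_div_mul_sq_le_one {b : ℂ} (hb : 0 ≤ b.re) (x : ℝ) :
    ‖Complex.exp (-Real.pi / b * x ^ 2)‖ ≤ 1 := by
  rw [Complex.norm_exp, Real.exp_le_one_iff]
  have h : (-Real.pi / b * x ^ 2 : ℂ).re = -(Real.pi * x ^ 2 * (b.re / Complex.normSq b)) := by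
    rw [← Complex.inv_re, ← Complex.re_ofReal_mul, ← Complex.neg_re]
    congr 1
    push_cast
    ring
  rw [h, neg_nonpos]
  have := Real.pi_pos
  have := Complex.normSq_nonneg b
  positivity

theorem integral_fourier_mul_gaussian_of_re_nonneg {f : ℝ → ℂ} (hf : Integrable f)
    (hf' : Integrable (𝓕 f)) {b : ℂ} (hb : 0 ≤ b.re) (hb' : b ∈ Complex.slitPlane)
    (ξ : ℝ) :
    ∫ w, 𝓕 f w * Complex.exp (-Real.pi * b * w ^ 2 + 2 * Real.pi * (-(Complex.I * ξ)) * w) =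
      1 / b ^ (1 / 2 : ℂ) * ∫ x, f x * Complex.exp (-Real.pi / b * (x + ξ) ^ 2) := by
  have hbε : Tendsto (fun ε : ℝ => b + ε) (𝓝[>] 0) (𝓝 b) := by
    have : Continuous fun ε : ℝ => b + ε := by fun_prop
    simpa using (this.tendsto 0).mono_left nhdsWithin_le_nhds
  have hre : ∀ᶠ ε : ℝ in 𝓝[>] 0, 0 < (b + ε).re := by
    filter_upwards [self_mem_nhdsWithin] with ε hε
    simpa using add_pos_of_nonneg_of_pos hb hε
  have hleft := tendsto_integral_mul_of_norm_le_one hf'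
    (g := fun (ε : ℝ) w => Complex.exp (-Real.pi * (b + ε) * w ^ 2 +
      2 * Real.pi * (-(Complex.I * ξ)) * w)) (fun ε => by fun_prop)
    (hre.mono fun ε hε w => norm_cexp_neg_pi_mul_sq_le_one hε.le w ξ) (fun w =>
      (Complex.continuous_exp.tendsto _).comp (((hbε.const_mul _).mul_const _).add_const _))
  have hb0 := Complex.slitPlane_ne_zero hb'
  have hright := tendsto_integral_mul_of_norm_le_one hf
    (g := fun (ε : ℝ) x => Complex.exp (-Real.pi / (b + ε) * (x + ξ) ^ 2))
    (fun ε => by fun_prop)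
    (hre.mono fun ε hε x => by exact_mod_cast norm_cexp_neg_pi_div_mul_sq_le_one hε.le (x + ξ))
    (fun x => (Complex.continuous_exp.tendsto _).comp
      ((tendsto_const_nhds.div hbε hb0).mul_const _))
  have hroot : Tendsto (fun ε : ℝ => 1 / (b + ε) ^ (1 / 2 : ℂ)) (𝓝[>] 0)
      (𝓝 (1 / b ^ (1 / 2 : ℂ))) :=
    tendsto_const_nhds.div (hbε.cpow tendsto_const_nhds hb')
      (by simp [Complex.cpow_eq_zero_iff, hb0])
  refine tendsto_nhds_unique_of_eventuallyEq hleft (hroot.mul hright) ?_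
  filter_upwards [hre] with ε hε
  rw [integral_fourier_mul_gaussian hf hε]
  simp only [mul_neg, ← mul_assoc, Complex.I_mul_I, neg_mul, one_mul, neg_neg]

theorem fourier_chirp_mul_fourier {f : ℝ → ℂ} (hf : Integrable f) (hf' : Integrable (𝓕 f)) {s : ℝ}
    (hs : s ≠ 0) (ξ : ℝ) :
    𝓕 (fun w => e ((1 / 2) * s * w ^ 2) * 𝓕 f w) ξ =
      1 / (-(s * Complex.I)) ^ (1 / 2 : ℂ) * (e (-((1 / 2) * ξ ^ 2 / s)) *
        𝓕 (fun x => e (-((1 / 2) * x ^ 2 / s)) * f x) (ξ / s)) := by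
  have hb : -(s * Complex.I) ∈ Complex.slitPlane :=
    Complex.mem_slitPlane_iff.mpr (.inr (by simpa using hs))
  have hleft (w : ℝ) : 𝐞 (-(w * ξ)) • (e ((1 / 2) * s * w ^ 2) * 𝓕 f w) =
      𝓕 f w * Complex.exp (-Real.pi * -(s * Complex.I) * w ^ 2 +
        2 * Real.pi * (-(Complex.I * ξ)) * w) := by
    rw [Circle.smul_def, Real.fourierChar_apply, e, smul_eq_mul, ← mul_assoc, ← Complex.exp_add,
      mul_comm]
    congr 2
    push_cast
    ring
  have hright (x : ℝ) :
      e (-((1 / 2) * ξ ^ 2 / s)) * 𝐞 (-(x * (ξ / s))) • (e (-((1 / 2) * x ^ 2 / s)) * f x) =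
        f x * Complex.exp (-Real.pi / -(s * Complex.I) * (x + ξ) ^ 2) := by
    rw [Circle.smul_def, Real.fourierChar_apply, e, e, smul_eq_mul, ← mul_assoc, ← mul_assoc,
      ← Complex.exp_add, ← Complex.exp_add, mul_comm]
    congr 2
    push_cast
    field_simp
    ring_nf
    rw [Complex.I_sq]
    ring
  rw [Real.fourier_real_eq, Real.fourier_real_eq, ← integral_const_mul]
  simp only [hleft, hright]
  exact integral_fourier_mul_gaussian_of_re_nonneg hf hf' (by simp) hb ξ

theorem integrable_e_mul {f : ℝ → ℂ} (hf : Integrable f) {θ : ℝ → ℝ} (hθ : Measurable θ) :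
    Integrable fun x => e (θ x) * f x := by
  simpa only [mul_comm] using (memLp_one_iff_integrable.mp
    (memLp_mul_e (memLp_one_iff_integrable.mpr hf) hθ))

theorem fourier_toLp_of_integrable {f : ℝ → ℂ} (hf : Integrable f) (hf₂ : MemLp f 2)
    (hFf : MemLp (𝓕 f) 2) : 𝓕 (hf₂.toLp f) = hFf.toLp (𝓕 f) :=
  fourier_toLp_eq hf₂ hFf fun φ => by
    simpa only [one_mul, smul_eq_mul, SchwartzMap.fourier_coe]
      using integral_fourier_comp_mul_left φ.integrable hf 1

theorem fourier_toLp_chirp_mul_fourier {f : ℝ → ℂ} (hf : Integrable f) {s : ℝ} (hs : s ≠ 0)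
    (hG : MemLp (fun w => e ((1 / 2) * s * w ^ 2) * 𝓕 f w) 2)
    (hH : MemLp (fun ξ => e (-((1 / 2) * ξ ^ 2 / s)) *
      𝓕 (fun x => e (-((1 / 2) * x ^ 2 / s)) * f x) (ξ / s)) 2) :
    𝓕 (hG.toLp _) = (1 / (-(s * Complex.I)) ^ (1 / 2 : ℂ)) • hH.toLp _ := by
  rw [← MemLp.toLp_const_smul]
  refine fourier_toLp_eq hG _ fun φ => ?_
  have hφ : Integrable (𝓕 (φ : ℝ → ℂ)) := by
    rw [← SchwartzMap.fourier_coe]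
    exact (𝓕 φ).integrable
  have hf' := integrable_e_mul hf (θ := fun x => -((1 / 2) * x ^ 2 / s)) (by fun_prop)
  have hφ' := integrable_e_mul φ.integrable (θ := fun x => -((1 / 2) * x ^ 2 / s)) (by fun_prop)
  set κ := 1 / (-(s * Complex.I)) ^ (1 / 2 : ℂ)
  calc ∫ w, 𝓕 φ w • (e ((1 / 2) * s * w ^ 2) * 𝓕 f w)
      = ∫ w, 𝓕 f (1 * w) * (e ((1 / 2) * s * w ^ 2) * 𝓕 (φ : ℝ → ℂ) w) := by
        congr 1 with w
        rw [one_mul, smul_eq_mul, SchwartzMap.fourier_coe]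
        ring
    _ = ∫ x, f x * 𝓕 (fun w => e ((1 / 2) * s * w ^ 2) * 𝓕 (φ : ℝ → ℂ) w) (1 * x) :=
        integral_fourier_comp_mul_left hf (integrable_e_mul hφ (by fun_prop)) 1
    _ = κ * ∫ x, 𝓕 (fun x => e (-((1 / 2) * x ^ 2 / s)) * φ x) (s⁻¹ * x) *
          (e (-((1 / 2) * x ^ 2 / s)) * f x) := by
        rw [← integral_const_mul]
        congr 1 with x
        rw [one_mul, fourier_chirp_mul_fourier φ.integrable hφ hs, div_eq_inv_mul x]
        ring
    _ = κ * ∫ ξ, e (-((1 / 2) * ξ ^ 2 / s)) * φ ξ *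
          𝓕 (fun x => e (-((1 / 2) * x ^ 2 / s)) * f x) (s⁻¹ * ξ) := by
        rw [integral_fourier_comp_mul_left hφ' hf' s⁻¹]
    _ = ∫ ξ, φ ξ • (κ • fun ξ => e (-((1 / 2) * ξ ^ 2 / s)) *
          𝓕 (fun x => e (-((1 / 2) * x ^ 2 / s)) * f x) (ξ / s)) ξ := by
        rw [← integral_const_mul]
        congr 1 with ξ
        rw [Pi.smul_apply, smul_eq_mul, smul_eq_mul, div_eq_inv_mul ξ]
        ring

theorem fourier_weilBorel {a : ℝ} (ha : a ≠ 0) (b w : ℝ) :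
    𝓕 (weilBorel a b) w = weilBigCell 0 a b w := by
  have ha' : 0 < |a| := abs_pos.mpr ha
  have hfresnel : ∫ t, chi t * e ((1 / 2) * (b / a) * t ^ 2 - w / a * t) =
      fresnel (b / a) (w / a) := by
    rw [fresnel, intervalIntegral.integral_of_le zero_le_one,
      ← integral_indicator measurableSet_Ioc]
    congr 1 with t
    by_cases ht : t ∈ Set.Ioc (0 : ℝ) 1
    · rw [chi, Set.indicator_of_mem ht, Set.indicator_of_mem ht, one_mul]
    · rw [chi, Set.indicator_of_notMem ht, Set.indicator_of_notMem ht, zero_mul]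
  have hphase (t : ℝ) : 𝐞 (-(t * w)) • weilBorel a b t = ((|a| ^ (1 / 2 : ℝ) : ℝ) : ℂ) *
      (chi (a * t) * e ((1 / 2) * (b / a) * (a * t) ^ 2 - w / a * (a * t))) := by
    have h : 𝐞 (-(t * w)) * e ((1 / 2) * (a * b) * t ^ 2) =
        e ((1 / 2) * (b / a) * (a * t) ^ 2 - w / a * (a * t)) := by
      rw [Real.fourierChar_apply, e, e, ← Complex.exp_add]
      congr 1
      have ha'' : (a : ℂ) ≠ 0 := Complex.ofReal_ne_zero.mpr ha
      push_cast
      field_simp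
      ring
    rw [weilBorel, Circle.smul_def, smul_eq_mul, ← h]
    ring
  have hpow : |a| ^ (1 / 2 : ℝ) * |a|⁻¹ = |a| ^ (-(1 / 2) : ℝ) := by
    rw [← Real.rpow_neg_one, ← Real.rpow_add ha']
    norm_num
  rw [Real.fourier_real_eq]
  simp only [hphase]
  rw [integral_const_mul, Measure.integral_comp_mul_left
    (fun t => chi t * e ((1 / 2) * (b / a) * t ^ 2 - w / a * t)), hfresnel, weilBigCell, ← hpow,
    abs_inv, Complex.real_smul]
  simp only [mul_zero, zero_mul, zero_div, e_zero]
  push_cast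
  ring

theorem weilBigCell_eq_e_mul (a c d w : ℝ) :
    weilBigCell a c d w = e ((1 / 2) * (a / c) * w ^ 2) * weilBigCell 0 c d w := by
  simp only [weilBigCell, mul_zero, zero_mul, zero_div, e_zero]
  rw [show (1 / 2) * a * w ^ 2 / c = (1 / 2) * (a / c) * w ^ 2 by ring]
  ring

theorem e_mul_weilBorel {a b c d : ℝ} (ha : a ≠ 0) (hc : c ≠ 0) (hdet : a * d - b * c = 1) (x : ℝ) :
    e (-((1 / 2) * x ^ 2 / (a / c))) * weilBorel c d x = weilBorel c (b * c / a) x := by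
  have h : e (-((1 / 2) * x ^ 2 / (a / c))) * e ((1 / 2) * (c * d) * x ^ 2) =
      e ((1 / 2) * (c * (b * c / a)) * x ^ 2) := by
    rw [← e_add]
    congr 1
    field_simp
    linear_combination x ^ 2 * hdet
  rw [weilBorel, weilBorel, ← h]
  ring

theorem e_mul_fourier_e_mul_weilBorel {a b c d : ℝ} (ha : a ≠ 0) (hc : c ≠ 0)
    (hdet : a * d - b * c = 1) (ξ : ℝ) :
    e (-((1 / 2) * ξ ^ 2 / (a / c))) *
        𝓕 (fun x => e (-((1 / 2) * x ^ 2 / (a / c))) * weilBorel c d x) (ξ / (a / c)) =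
      ((|a / c| ^ (1 / 2 : ℝ) : ℝ) : ℂ) * weilBigCell (-c) a b ξ := by
  have hpow : |a / c| ^ (1 / 2 : ℝ) * |a| ^ (-(1 / 2) : ℝ) = |c| ^ (-(1 / 2) : ℝ) := by
    have ha' : 0 < |a| := abs_pos.mpr ha
    rw [abs_div, Real.div_rpow ha'.le (abs_nonneg c), div_mul_eq_mul_div, ← Real.rpow_add ha',
      Real.rpow_neg (abs_nonneg c)]
    norm_num
  have hphase : -((1 / 2) * ξ ^ 2 / (a / c)) = (1 / 2) * (-c / a) * ξ ^ 2 := by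
    field_simp
  rw [funext (e_mul_weilBorel ha hc hdet), fourier_weilBorel hc, weilBigCell_eq_e_mul (-c), hphase,
    weilBigCell, weilBigCell, ← hpow, show b * c / a / c = b / a by field_simp,
    show ξ / (a / c) / c = ξ / a by field_simp]
  simp only [mul_zero, zero_mul, zero_div]
  push_cast
  ring

theorem norm_fourier_chirp_const {s : ℝ} (hs : s ≠ 0) :
    ‖1 / (-(s * Complex.I)) ^ (1 / 2 : ℂ) * ((|s| ^ (1 / 2 : ℝ) : ℝ) : ℂ)‖ = 1 := by
  have : 0 < |s| := abs_pos.mpr hs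
  have hnorm : ‖-((s : ℂ) * Complex.I)‖ = |s| := by
    rw [norm_neg, norm_mul, Complex.norm_I, mul_one, Complex.norm_real, Real.norm_eq_abs]
  rw [show (1 / 2 : ℂ) = ((1 / 2 : ℝ) : ℂ) by push_cast; rfl, norm_mul, norm_div, norm_one,
    Complex.norm_cpow_real, hnorm, Complex.norm_real, Real.norm_of_nonneg (by positivity)]
  field_simp

theorem fourier_weilBigCell {a b c d : ℝ} (ha : a ≠ 0) (hc : c ≠ 0) (hdet : a * d - b * c = 1) :
    ∃ κ : ℂ, ‖κ‖ = 1 ∧ 𝓕 ((memLp_weilBigCell (a := a) (d := d) hc).toLp _) =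
      κ • (memLp_weilBigCell (a := -c) (d := b) ha).toLp _ := by
  have hs : a / c ≠ 0 := div_ne_zero ha hc
  have hG : weilBigCell a c d =
      fun w => e ((1 / 2) * (a / c) * w ^ 2) * 𝓕 (weilBorel c d) w := by
    ext w
    rw [weilBigCell_eq_e_mul, fourier_weilBorel hc]
  have hH : (fun ξ => e (-((1 / 2) * ξ ^ 2 / (a / c))) *
      𝓕 (fun x => e (-((1 / 2) * x ^ 2 / (a / c))) * weilBorel c d x) (ξ / (a / c))) =
      ((|a / c| ^ (1 / 2 : ℝ) : ℝ) : ℂ) • weilBigCell (-c) a b :=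
    funext (e_mul_fourier_e_mul_weilBorel ha hc hdet)
  have h := fourier_toLp_chirp_mul_fourier
    (memLp_one_iff_integrable.mp (memLp_weilBorel hc d 1)) hs
    (hG ▸ memLp_weilBigCell hc) (hH ▸ (memLp_weilBigCell ha).const_smul _)
  simp only [← hG, hH] at h
  refine ⟨_, norm_fourier_chirp_const hs, ?_⟩
  rw [h, mul_smul]
  rfl

/-! ### Invariance under the modular group -/

section Invariance

open ModularGroup

theorem coe_S_mul (M : SL(2, ℝ)) :
    ((S : SL(2, ℝ)) * M).1 = !![-M.1 1 0, -M.1 1 1; M.1 0 0, M.1 0 1] := by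
  ext i j
  fin_cases i <;> fin_cases j <;>
    simp [Matrix.SpecialLinearGroup.map_apply_coe, coe_S, Matrix.mul_apply, Fin.sum_univ_two]

theorem coe_T_mul (M : SL(2, ℝ)) :
    ((T : SL(2, ℝ)) * M).1 = !![M.1 0 0 + M.1 1 0, M.1 0 1 + M.1 1 1; M.1 1 0, M.1 1 1] := by
  ext i j
  fin_cases i <;> fin_cases j <;>
    simp [Matrix.SpecialLinearGroup.map_apply_coe, coe_T, Matrix.mul_apply, Fin.sum_univ_two]

theorem S_mul_S_mul (M : SL(2, ℝ)) : (S : SL(2, ℝ)) * ((S : SL(2, ℝ)) * M) = -M := by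
  ext i j
  rw [coe_S_mul, coe_S_mul]
  fin_cases i <;> fin_cases j <;> simp

theorem weil_T_mul (M : SL(2, ℝ)) :
    weil (T * M) = fun w => e ((1 / 2) * w ^ 2) * weil M w := by
  have hrow := row_pos M
  have hv : iwV (T * M) = iwV M := by
    rw [iwV, coe_T_mul]
    rfl
  have hphi : iwPhi (T * M) = iwPhi M := by
    rw [iwPhi, coe_T_mul]
    rfl
  have hu : iwU (T * M) = iwU M + 1 := by
    simp only [iwU, coe_T_mul, Matrix.of_apply, Matrix.cons_val]
    field_simp
    ring
  ext w
  rw [weil, weil, hv, hphi, hu, mul_add, e_add, mul_one]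
  ring

theorem nuG_T_mul (M : SL(2, ℝ)) : nuG (T * M) = nuG M := by
  rw [nuG_eq_law, nuG_eq_law, weilLp, weilLp]
  simp only [weil_T_mul]
  exact law_zak_chirp (memLp_weil M) _

theorem fourier_weilLp {M : SL(2, ℝ)} (ha : M.1 0 0 ≠ 0) :
    ∃ κ : ℂ, ‖κ‖ = 1 ∧ 𝓕 (weilLp M) = κ • weilLp (S * M) := by
  have hS : weil (S * M) = weilBigCell (-M.1 1 0) (M.1 0 0) (M.1 0 1) := by
    ext w
    rw [weil_eq_weilBigCell (by rwa [coe_S_mul]), coe_S_mul]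
    rfl
  simp only [weilLp, hS]
  rcases eq_or_ne (M.1 1 0) 0 with hc | hc
  · refine ⟨1, norm_one, ?_⟩
    simp only [funext (weil_eq_weilBorel hc), hc, neg_zero, one_smul]
    have hF := funext (fourier_weilBorel ha (M.1 0 1))
    rw [fourier_toLp_of_integrable (memLp_one_iff_integrable.mp (memLp_weilBorel ha _ 1)) _
      (hF ▸ memLp_weilBigCell ha)]
    simp only [hF]
  · simp only [funext (weil_eq_weilBigCell hc)]
    exact fourier_weilBigCell ha hc (det_eq_one M)

theorem nuG_S_mul_of_ne_zero {M : SL(2, ℝ)} (ha : M.1 0 0 ≠ 0) : nuG (S * M) = nuG M := by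
  obtain ⟨κ, hκ, h⟩ := fourier_weilLp ha
  rw [nuG_eq_law, nuG_eq_law, ← law_zak_fourier (weilLp M), h, map_smul, law_smul hκ]

theorem nuG_S_mul (M : SL(2, ℝ)) : nuG (S * M) = nuG M := by
  rcases ne_or_eq (M.1 0 0) 0 with ha | ha
  · exact nuG_S_mul_of_ne_zero ha
  have hc : M.1 1 0 ≠ 0 := fun hc => by simpa [ha, hc] using det_eq_one M
  -- `M` has upper left entry `0`, but `S * M`, `T * M` and `S * (T * M)` do not.
  calc nuG (S * M) = nuG (S * (S * M)) :=
        (nuG_S_mul_of_ne_zero (by rw [coe_S_mul]; exact neg_ne_zero.mpr hc)).symm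
    _ = nuG (T * (S * (S * M))) := (nuG_T_mul _).symm
    _ = nuG (S * (S * (T * M))) := by rw [S_mul_S_mul, S_mul_S_mul, mul_neg]
    _ = nuG (S * (T * M)) :=
        nuG_S_mul_of_ne_zero (by rw [coe_S_mul, coe_T_mul]; exact neg_ne_zero.mpr hc)
    _ = nuG (T * M) :=
        nuG_S_mul_of_ne_zero (by rw [coe_T_mul]; simpa [ha] using hc)
    _ = nuG M := nuG_T_mul M

theorem nuG_mul_of_mem {γ : SL(2, ℝ)} (hγ : γ ∈ Gam) (M : SL(2, ℝ)) : nuG (γ * M) = nuG M := by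
  have hGam : Gam = Subgroup.closure {(S : SL(2, ℝ)), (T : SL(2, ℝ))} := by
    rw [Gam, MonoidHom.range_eq_map, ← SpecialLinearGroup.SL2Z_generators, MonoidHom.map_closure,
      Set.image_pair]
  rw [hGam] at hγ
  induction hγ using Subgroup.closure_induction generalizing M with
  | mem x hx =>
    rcases hx with rfl | rfl
    · exact nuG_S_mul M
    · exact nuG_T_mul M
  | one => rw [one_mul]
  | mul x y _ _ hx hy => rw [mul_assoc, hx, hy]
  | inv x _ hx => rw [← hx, mul_inv_cancel_left]

end Invariance

/-! ### Continuity -/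

theorem tendsto_eLpNorm_sub_of_dominated {α E ι : Type*} [MeasurableSpace α]
    [NormedAddCommGroup E] {μ : Measure α} {p : ℝ≥0∞} (hp : p ≠ ∞) {l : Filter ι}
    [l.IsCountablyGenerated] {f : ι → α → E} {g : α → E} {bound : α → ℝ}
    (hf : ∀ i, AEStronglyMeasurable (f i) μ) (hg : MemLp g p μ) (hbound : MemLp bound p μ)
    (hle : ∀ᶠ i in l, ∀ᵐ x ∂μ, ‖f i x‖ ≤ bound x)
    (hlim : ∀ᵐ x ∂μ, Tendsto (f · x) l (𝓝 (g x))) :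
    Tendsto (fun i => eLpNorm (f i - g) p μ) l (𝓝 0) := by
  rcases eq_or_ne p 0 with rfl | hp0
  · simp only [eLpNorm_exponent_zero, tendsto_const_nhds]
  have hp' : 0 < p.toReal := ENNReal.toReal_pos hp0 hp
  simp only [eLpNorm_eq_lintegral_rpow_enorm_toReal hp0 hp]
  suffices h : Tendsto (fun i => ∫⁻ x, ‖(f i - g) x‖ₑ ^ p.toReal ∂μ) l (𝓝 0) by
    simpa only [ENNReal.zero_rpow_of_pos (one_div_pos.mpr hp')] using h.ennrpow_const (1 / p.toReal)
  rw [← lintegral_zero]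
  refine tendsto_lintegral_filter_of_dominated_convergence'
    (fun x => ‖(bound + fun y => ‖g y‖) x‖ₑ ^ p.toReal)
    (.of_forall fun i => ((hf i).sub hg.1).enorm.pow_const _) ?_
    (lintegral_rpow_enorm_lt_top_of_eLpNorm_lt_top hp0 hp (hbound.add hg.norm).eLpNorm_lt_top).ne ?_
  · filter_upwards [hle] with i hi
    filter_upwards [hi] with x hx
    gcongr
    rw [enorm_le_iff_norm_le]
    exact (norm_sub_le _ _).trans ((add_le_add_left hx _).trans (le_abs_self _))
  · filter_upwards [hlim] with x hx
    have hsub : Tendsto (fun i => ‖f i x - g x‖ₑ) l (𝓝 0) := by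
      simpa using (hx.sub_const (g x)).enorm
    simpa only [Pi.sub_apply, ENNReal.zero_rpow_of_pos hp'] using hsub.ennrpow_const p.toReal

instance : FirstCountableTopology SL(2, ℝ) :=
  haveI : FirstCountableTopology (Matrix (Fin 2) (Fin 2) ℝ) :=
    inferInstanceAs (FirstCountableTopology (Fin 2 → Fin 2 → ℝ))
  Topology.IsInducing.subtypeVal.firstCountableTopology

theorem continuous_entry (i j : Fin 2) : Continuous fun M : SL(2, ℝ) => M.1 i j :=
  continuous_subtype_val.matrix_elem i j

theorem eventually_norm_weil_sq_le {M : SL(2, ℝ)} (hc : M.1 1 0 ≠ 0) :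
    ∃ C : ℝ, ∀ᶠ N in 𝓝 M, ∀ w, ‖weil N w‖ ^ 2 ≤ C * (1 + w ^ 2)⁻¹ := by
  have hcont (j : Fin 2) : Tendsto (fun N : SL(2, ℝ) => |N.1 1 j|) (𝓝 M) (𝓝 |M.1 1 j|) :=
    ((continuous_entry 1 j).tendsto M).abs
  have hc' : 0 < |M.1 1 0| := abs_pos.mpr hc
  have hd' : 0 ≤ |M.1 1 1| := abs_nonneg _
  set A : ℝ := 1 + |M.1 1 0| + |M.1 1 1|
  refine ⟨2 * A + (1 + 4 * A ^ 2) / (|M.1 1 0| / 2), ?_⟩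
  filter_upwards [(hcont 0).eventually (lt_mem_nhds (half_lt_self hc')),
    (hcont 0).eventually (gt_mem_nhds (show _ < A by linarith)),
    (hcont 1).eventually (gt_mem_nhds (show _ < A by linarith))] with N hδ hcA hdA w
  rw [weil_eq_weilBigCell (abs_pos.mp ((half_pos hc').trans hδ))]
  exact norm_weilBigCell_sq_le (by linarith) (half_pos hc') hδ.le hcA.le hdA.le w

theorem continuousAt_weil {M : SL(2, ℝ)} (hc : M.1 1 0 ≠ 0) (w : ℝ) :
    ContinuousAt (fun N => weil N w) M := by
  have hentries : ContinuousAt (fun N : SL(2, ℝ) => (N.1 0 0, N.1 1 0, N.1 1 1)) M :=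
    ((continuous_entry 0 0).prodMk
      ((continuous_entry 1 0).prodMk (continuous_entry 1 1))).continuousAt
  refine ((continuousAt_weilBigCell hc w).comp (x := M) hentries).congr ?_
  filter_upwards [(continuous_entry 1 0).continuousAt.eventually_ne hc] with N hN
  exact (weil_eq_weilBigCell hN w).symm

theorem continuousAt_nuG_of_ne_zero {M : SL(2, ℝ)} (hc : M.1 1 0 ≠ 0) : ContinuousAt nuG M := by
  obtain ⟨C, hC⟩ := eventually_norm_weil_sq_le hc
  have hC0 : 0 ≤ C := by simpa using (sq_nonneg _).trans (hC.self_of_nhds 0)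
  have hbound : MemLp (fun w : ℝ => Real.sqrt (C * (1 + w ^ 2)⁻¹)) 2 :=
    memLp_two_of_norm_sq_le (C := C) (by fun_prop) fun w => by
      rw [Real.norm_of_nonneg (Real.sqrt_nonneg _), Real.sq_sqrt (by positivity)]
  rw [ContinuousAt, funext nuG_eq_law]
  refine ((continuous_law.comp zak.continuous).tendsto _).comp
    ((Lp.tendsto_Lp_iff_tendsto_eLpNorm'' _ memLp_weil _ (memLp_weil M)).mpr
      (tendsto_eLpNorm_sub_of_dominated ENNReal.ofNat_ne_top (fun N => (memLp_weil N).1)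
        (memLp_weil M) hbound ?_ (.of_forall fun w => continuousAt_weil hc w)))
  filter_upwards [hC] with N hN
  exact .of_forall fun w => Real.le_sqrt_of_sq_le (hN w)

theorem continuous_nuG : Continuous nuG := by
  refine continuous_iff_continuousAt.mpr fun M => ?_
  rcases ne_or_eq (M.1 1 0) 0 with hc | hc
  · exact continuousAt_nuG_of_ne_zero hc
  · have ha : ((ModularGroup.S : SL(2, ℝ)) * M).1 1 0 ≠ 0 := by
      have hdet := det_eq_one M
      rw [hc, mul_zero, sub_zero] at hdet
      rw [coe_S_mul]
      exact left_ne_zero_of_mul_eq_one hdet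
    rw [← funext nuG_S_mul]
    exact (continuousAt_nuG_of_ne_zero ha).comp (continuous_const_mul _).continuousAt

/-! ### Escape into the cusp -/

theorem unif_compl_Ioo_le (η : ℝ) : unif (Set.Ioo η (1 - η))ᶜ ≤ ENNReal.ofReal (2 * η) := by
  have hsub : (Set.Ioo η (1 - η))ᶜ ∩ Set.Ico 0 1 ⊆ Set.Icc 0 η ∪ Set.Icc (1 - η) 1 := by
    rintro y ⟨hy, hy0, hy1⟩
    rcases le_or_gt y η with h | h
    · exact .inl ⟨hy0, h⟩
    · exact .inr ⟨not_lt.mp fun h' => hy ⟨h, h'⟩, hy1.le⟩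
  rw [unif, Measure.restrict_apply measurableSet_Ioo.compl]
  calc volume ((Set.Ioo η (1 - η))ᶜ ∩ Set.Ico 0 1)
      ≤ volume (Set.Icc 0 η) + volume (Set.Icc (1 - η) 1) :=
        (measure_mono hsub).trans (measure_union_le _ _)
    _ = ENNReal.ofReal (2 * η) := by
        rw [Real.volume_Icc, Real.volume_Icc, sub_zero, sub_sub_cancel, two_mul]
        rcases le_total 0 η with h | h
        · rw [ENNReal.ofReal_add h h]
        · simp [ENNReal.ofReal_of_nonpos, h]

theorem le_abs_intCast_sub {η y : ℝ} (hy : y ∈ Set.Ioo η (1 - η)) (n : ℤ) : η ≤ |n - y| := by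
  obtain ⟨h0, h1⟩ := hy
  rw [le_abs]
  rcases le_or_gt n 0 with hn | hn
  · have : (n : ℝ) ≤ 0 := by exact_mod_cast hn
    exact .inr (by linarith)
  · have : (1 : ℝ) ≤ n := by exact_mod_cast hn
    exact .inl (by linarith)

theorem zak_toLp_eq_of_eq_tail {f g : ℝ → ℂ} (hf : MemLp f 2) (hg : MemLp g 2) {η : ℝ}
    (h : ∀ w, η ≤ |w| → f w = g w) :
    ∀ᵐ p ∂(unif.prod unif), p.2 ∈ Set.Ioo η (1 - η) →
      zak (hf.toLp f) p = zak (hg.toLp g) p := by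
  have hzero := zak_toLp_eq_of_hasSum (hf.sub hg) (F := 0)
    (A := {p | p.2 ∈ Set.Ioo η (1 - η)}) (.of_forall fun p hp => by
      have hterm (n : ℤ) : zakTerm (f - g) n p = 0 := by
        rw [zakTerm, Pi.sub_apply, h _ (le_abs_intCast_sub hp n), sub_self, zero_mul]
      simp only [hterm]
      exact hasSum_zero)
  rw [MemLp.toLp_sub hf hg, map_sub] at hzero
  filter_upwards [hzero, Lp.coeFn_sub (zak (hf.toLp f)) (zak (hg.toLp g))] with p hp hsub hpA
  rw [← sub_eq_zero, ← Pi.sub_apply, ← hsub]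
  exact hp hpA

theorem measure_le_edist_zak_le {f g : ℝ → ℂ} (hf : MemLp f 2) (hg : MemLp g 2) {η : ℝ}
    (h : ∀ w, η ≤ |w| → f w = g w) (G : Lp ℂ 2 (unif.prod unif)) (ε : ℝ≥0∞) :
    (unif.prod unif) {p | ε ≤ edist (zak (hf.toLp f) p) (G p)} ≤
      ENNReal.ofReal (2 * η) + (unif.prod unif) {p | ε ≤ edist (zak (hg.toLp g) p) (G p)} := by
  calc (unif.prod unif) {p | ε ≤ edist (zak (hf.toLp f) p) (G p)}
      ≤ (unif.prod unif) (Prod.snd ⁻¹' (Set.Ioo η (1 - η))ᶜ ∪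
          {p | ε ≤ edist (zak (hg.toLp g) p) (G p)}) := by
        refine measure_mono_ae ?_
        filter_upwards [zak_toLp_eq_of_eq_tail hf hg h] with p hp hpε
        refine or_iff_not_imp_left.mpr fun hpη => ?_
        change ε ≤ edist _ _
        rw [← hp (not_not.mp hpη)]
        exact hpε
    _ ≤ unif (Set.Ioo η (1 - η))ᶜ +
          (unif.prod unif) {p | ε ≤ edist (zak (hg.toLp g) p) (G p)} := by
        refine (measure_union_le _ _).trans_eq ?_
        rw [measurePreserving_snd.measure_preimage measurableSet_Ioo.compl.nullMeasurableSet]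
    _ ≤ _ := by
        gcongr
        exact unif_compl_Ioo_le η

theorem measurableSet_tail (η : ℝ) : MeasurableSet {w : ℝ | η ≤ |w|} :=
  measurableSet_le measurable_const (by fun_prop)

theorem exists_pos_ofReal_two_mul_le {δ : ℝ≥0∞} (hδ : 0 < δ) :
    ∃ η : ℝ, 0 < η ∧ ENNReal.ofReal (2 * η) ≤ δ := by
  have hcont : Tendsto (fun η : ℝ => ENNReal.ofReal (2 * η)) (𝓝[>] 0) (𝓝 0) := by
    have h : Continuous fun η : ℝ => ENNReal.ofReal (2 * η) :=
      ENNReal.continuous_ofReal.comp (by fun_prop)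
    simpa using (h.tendsto 0).mono_left nhdsWithin_le_nhds
  obtain ⟨η, hηδ, hη⟩ := ((hcont.eventually (ge_mem_nhds hδ)).and self_mem_nhdsWithin).exists
  exact ⟨η, hη, hηδ⟩

theorem tendstoInMeasure_zak_zero_of_tail {ι : Type*} {l : Filter ι} {f : ι → ℝ → ℂ}
    (hf : ∀ i, MemLp (f i) 2)
    (htail : ∀ η > 0, Tendsto (fun i => eLpNorm ({w : ℝ | η ≤ |w|}.indicator (f i)) 2) l (𝓝 0)) :
    TendstoInMeasure (unif.prod unif) (fun i => ⇑(zak ((hf i).toLp _))) l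
      (0 : Lp ℂ 2 (unif.prod unif)) := by
  have hg (η : ℝ) (i : ι) := (hf i).indicator (measurableSet_tail η)
  have hlim (η : ℝ) (hη : 0 < η) : Tendsto (fun i => zak ((hg η i).toLp _)) l (𝓝 0) := by
    have h : Tendsto (fun i => (hg η i).toLp _) l (𝓝 (MemLp.zero.toLp 0)) :=
      (Lp.tendsto_Lp_iff_tendsto_eLpNorm'' _ (hg η) _ MemLp.zero).mpr (by simpa using htail η hη)
    simpa [Function.comp_def] using (zak.continuous.tendsto _).comp h
  intro ε hε
  refine ENNReal.tendsto_nhds_zero.mpr fun δ hδ => ?_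
  obtain ⟨η, hη, hηδ⟩ := exists_pos_ofReal_two_mul_le (ENNReal.half_pos hδ.ne')
  filter_upwards [ENNReal.tendsto_nhds_zero.mp (tendstoInMeasure_of_tendsto_Lp (hlim η hη) ε hε)
    (δ / 2) (ENNReal.half_pos hδ.ne')] with i hi
  calc _ ≤ _ := measure_le_edist_zak_le (hf i) (hg η i)
        (fun w hw => (Set.indicator_of_mem (s := {w : ℝ | η ≤ |w|}) hw _).symm) 0 ε
    _ ≤ δ / 2 + δ / 2 := add_le_add hηδ hi
    _ = δ := ENNReal.add_halves δ

theorem inv_iwV (M : SL(2, ℝ)) : (iwV M)⁻¹ = M.1 1 0 ^ 2 + M.1 1 1 ^ 2 := by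
  rw [iwV, one_div, inv_inv]

theorem norm_weil_sq_le_div {M : SL(2, ℝ)} {w : ℝ} (hw : 2 * Real.sqrt (iwV M)⁻¹ ≤ |w|) :
    ‖weil M w‖ ^ 2 ≤ Real.sqrt (iwV M)⁻¹ / w ^ 2 := by
  have hv := inv_iwV M
  have hc : |M.1 1 0| ≤ Real.sqrt (iwV M)⁻¹ :=
    Real.abs_le_sqrt (by linarith [sq_nonneg (M.1 1 1)])
  have hd : |M.1 1 1| ≤ Real.sqrt (iwV M)⁻¹ :=
    Real.abs_le_sqrt (by linarith [sq_nonneg (M.1 1 0)])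
  rcases eq_or_ne (M.1 1 0) 0 with h | h
  · have hdet : |M.1 0 0| * |M.1 1 1| = 1 := by
      have hdet := det_eq_one M
      rw [h, mul_zero, sub_zero] at hdet
      rw [← abs_mul, hdet, abs_one]
    have hchi : M.1 0 0 * w ∉ Set.Ioc (0 : ℝ) 1 := by
      rintro ⟨hpos, hle⟩
      have habs : |M.1 0 0| * |w| ≤ 1 := by rwa [← abs_mul, abs_of_pos hpos]
      have : |M.1 0 0| * (2 * |M.1 1 1|) ≤ |M.1 0 0| * |w| := by gcongr; linarith
      linarith
    rw [weil_eq_weilBorel h, weilBorel, chi, Set.indicator_of_notMem hchi, mul_zero, zero_mul,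
      norm_zero, zero_pow two_ne_zero]
    positivity
  · have hw0 : 0 < |w| := by linarith [abs_pos.mpr h]
    rw [weil_eq_weilBigCell h]
    refine (norm_weilBigCell_sq_le_div h (abs_pos.mp hw0) (by linarith)).trans ?_
    gcongr

theorem inv_sq_le_mul_inv_one_add_sq {η w : ℝ} (hη : 0 < η) (hw : η ≤ |w|) :
    (w ^ 2)⁻¹ ≤ (1 + (η ^ 2)⁻¹) * (1 + w ^ 2)⁻¹ := by
  have hw2 : η ^ 2 ≤ w ^ 2 := sq_le_sq.mpr (by rwa [abs_of_pos hη])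
  have hw0 : 0 < w ^ 2 := (by positivity : 0 < η ^ 2).trans_le hw2
  rw [← div_eq_mul_inv, le_div_iff₀ (by positivity), mul_add, inv_mul_cancel₀ hw0.ne', mul_one,
    add_comm]
  gcongr

theorem tendsto_sqrt_inv_iwV :
    Tendsto (fun M => Real.sqrt (iwV M)⁻¹) (comap iwV atTop) (𝓝 0) := by
  have hinv := (tendsto_inv_atTop_zero (𝕜 := ℝ)).comp (tendsto_comap (f := iwV))
  simpa only [Real.sqrt_zero, Function.comp_def] using (Real.continuous_sqrt.tendsto 0).comp hinv

theorem eventually_norm_indicator_weil_sq_le {η : ℝ} (hη : 0 < η) :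
    ∀ᶠ M in comap iwV atTop, ∀ w, ‖{w : ℝ | η ≤ |w|}.indicator (weil M) w‖ ^ 2 ≤
      Real.sqrt (iwV M)⁻¹ * ((1 + (η ^ 2)⁻¹) * (1 + w ^ 2)⁻¹) := by
  filter_upwards [tendsto_sqrt_inv_iwV.eventually (gt_mem_nhds (half_pos hη))] with M hM w
  by_cases hw : η ≤ |w|
  · rw [Set.indicator_of_mem (s := {w : ℝ | η ≤ |w|}) hw]
    refine (norm_weil_sq_le_div (by linarith)).trans ?_
    rw [div_eq_mul_inv]
    gcongr
    exact inv_sq_le_mul_inv_one_add_sq hη hw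
  · rw [Set.indicator_of_notMem (s := {w : ℝ | η ≤ |w|}) hw, norm_zero, zero_pow two_ne_zero]
    positivity

theorem tendsto_eLpNorm_indicator_weil {η : ℝ} (hη : 0 < η) :
    Tendsto (fun M => eLpNorm ({w : ℝ | η ≤ |w|}.indicator (weil M)) 2) (comap iwV atTop)
      (𝓝 0) := by
  have hbound : MemLp (fun w : ℝ => Real.sqrt ((1 + (η ^ 2)⁻¹) * (1 + w ^ 2)⁻¹)) 2 :=
    memLp_two_of_norm_sq_le (C := 1 + (η ^ 2)⁻¹) (by fun_prop) fun w => by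
      rw [Real.norm_of_nonneg (Real.sqrt_nonneg _), Real.sq_sqrt (by positivity)]
  have htail := eventually_norm_indicator_weil_sq_le hη
  suffices h : Tendsto (fun M => eLpNorm ({w : ℝ | η ≤ |w|}.indicator (weil M) - 0) 2)
      (comap iwV atTop) (𝓝 0) by simpa only [sub_zero] using h
  refine tendsto_eLpNorm_sub_of_dominated ENNReal.ofNat_ne_top
    (fun M => (memLp_weil M).1.indicator (measurableSet_tail η)) MemLp.zero hbound ?_
    (.of_forall fun w => ?_)
  · filter_upwards [htail, tendsto_sqrt_inv_iwV.eventually (ge_mem_nhds one_pos)] with M hM hM1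
    exact .of_forall fun w => Real.le_sqrt_of_sq_le <|
      (hM w).trans (mul_le_of_le_one_left (by positivity) hM1)
  · have hsq : Tendsto (fun M => ‖{w : ℝ | η ≤ |w|}.indicator (weil M) w‖ ^ 2)
        (comap iwV atTop) (𝓝 0) :=
      squeeze_zero' (.of_forall fun M => sq_nonneg _) (htail.mono fun M hM => hM w)
        (by simpa using tendsto_sqrt_inv_iwV.mul_const ((1 + (η ^ 2)⁻¹) * (1 + w ^ 2)⁻¹))
    exact tendsto_zero_iff_norm_tendsto_zero.mpr (by simpa using hsq.sqrt)

theorem exists_iwV_eq {v : ℝ} (hv : 0 < v) : ∃ M : SL(2, ℝ), iwV M = v := by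
  have hs := (Real.sqrt_pos.mpr hv).ne'
  refine ⟨⟨!![Real.sqrt v, 0; 0, (Real.sqrt v)⁻¹], by simp [hs]⟩, ?_⟩
  simp [iwV, Real.sq_sqrt hv.le]

instance neBot_comap_iwV : (comap iwV atTop).NeBot := by
  refine comap_neBot_iff.mpr fun s hs => ?_
  obtain ⟨v, hvs, hv⟩ := ((eventually_mem_set.mpr hs).and (eventually_gt_atTop 0)).exists
  obtain ⟨M, rfl⟩ := exists_iwV_eq hv
  exact ⟨M, hvs⟩

theorem tendsto_nuG_cusp : Tendsto nuG (comap iwV atTop) (𝓝 delta0) := by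
  rw [← law_zero (E := ℂ) (p := 2) (μ := unif.prod unif), funext nuG_eq_law]
  exact tendsto_law_of_tendstoInMeasure
    (tendstoInMeasure_zak_zero_of_tail memLp_weil fun η => tendsto_eLpNorm_indicator_weil)

/-! ### Reduction theory -/

theorem coe_smul_I (M : SL(2, ℝ)) :
    ((M • UpperHalfPlane.I : UpperHalfPlane) : ℂ) = iwU M + iwV M * Complex.I := by
  have hdet : (M.1 0 0 : ℂ) * M.1 1 1 - M.1 0 1 * M.1 1 0 = 1 := by exact_mod_cast det_eq_one M
  have hrow : (M.1 1 0 : ℂ) ^ 2 + (M.1 1 1 : ℂ) ^ 2 ≠ 0 := by exact_mod_cast (row_pos M).ne'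
  have hdenom : (M.1 1 0 : ℂ) * Complex.I + M.1 1 1 ≠ 0 := by
    refine fun h => hrow ?_
    linear_combination (M.1 1 1 - M.1 1 0 * Complex.I) * h + (M.1 1 0 : ℂ) ^ 2 * Complex.I_sq
  rw [UpperHalfPlane.coe_specialLinearGroup_apply, UpperHalfPlane.coe_I]
  simp only [Algebra.algebraMap_self, RingHom.id_apply]
  rw [div_eq_iff hdenom, iwU, iwV]
  push_cast
  field_simp
  ring_nf
  simp only [Complex.I_sq]
  linear_combination ((M.1 1 1 : ℂ) * Complex.I - M.1 1 0) * hdet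

theorem re_smul_I (M : SL(2, ℝ)) : (M • UpperHalfPlane.I).re = iwU M := by
  simpa using congrArg Complex.re (coe_smul_I M)

theorem im_smul_I (M : SL(2, ℝ)) : (M • UpperHalfPlane.I).im = iwV M := by
  simpa using congrArg Complex.im (coe_smul_I M)

theorem intCast_smul (γ : SL(2, ℤ)) (z : UpperHalfPlane) : (γ : SL(2, ℝ)) • z = γ • z := by
  ext
  rw [UpperHalfPlane.coe_specialLinearGroup_apply _ z,
    UpperHalfPlane.coe_specialLinearGroup_apply γ z]
  rfl

theorem exists_mem_Gam_mul_reduced (M : SL(2, ℝ)) :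
    ∃ γ ∈ Gam, |iwU (γ * M)| ≤ 1 / 2 ∧ 1 / 2 ≤ iwV (γ * M) := by
  obtain ⟨γ, hγ⟩ := ModularGroup.exists_smul_mem_fd (M • UpperHalfPlane.I)
  have hsmul : ((γ : SL(2, ℝ)) * M) • UpperHalfPlane.I = γ • M • UpperHalfPlane.I := by
    rw [mul_smul, intCast_smul]
  refine ⟨γ, ⟨γ, rfl⟩, ?_, ?_⟩
  · rw [← re_smul_I, hsmul]
    exact hγ.2
  · have him := ModularGroup.three_le_four_mul_im_sq_of_mem_fd hγ
    rw [← hsmul, im_smul_I] at him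
    nlinarith [iwV_pos (γ * M)]

theorem isCompact_setOf_abs_entry_le {n : Type*} [Fintype n] [DecidableEq n] (B : ℝ) :
    IsCompact {M : Matrix.SpecialLinearGroup n ℝ | ∀ i j, |M.1 i j| ≤ B} := by
  have hdet : IsClosed {A : Matrix n n ℝ | A.det = 1} :=
    isClosed_eq (Continuous.matrix_det continuous_id) continuous_const
  have hbox : IsCompact (Set.univ.pi fun _ : n => Set.univ.pi fun _ : n => Set.Icc (-B) B) :=
    isCompact_univ_pi fun _ => isCompact_univ_pi fun _ => isCompact_Icc
  have hpre : {M : Matrix.SpecialLinearGroup n ℝ | ∀ i j, |M.1 i j| ≤ B} =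
      Subtype.val ⁻¹' Set.univ.pi fun _ => Set.univ.pi fun _ => Set.Icc (-B) B := by
    ext M
    exact ⟨fun h i _ j _ => abs_le.mp (h i j), fun h i j => abs_le.mpr (h i trivial j trivial)⟩
  rw [hpre]
  exact hdet.isClosedEmbedding_subtypeVal.isCompact_preimage hbox

theorem sq_topRow_eq (M : SL(2, ℝ)) :
    M.1 0 0 ^ 2 + M.1 0 1 ^ 2 = (iwU M ^ 2 + iwV M ^ 2) / iwV M := by
  have hrow := (row_pos M).ne'
  rw [eq_div_iff (iwV_pos M).ne', iwU, iwV]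
  field_simp
  linear_combination (M.1 0 0 * M.1 1 1 - M.1 0 1 * M.1 1 0 + 1) * det_eq_one M

theorem abs_entry_le_of_reduced {M : SL(2, ℝ)} {R : ℝ} (hu : |iwU M| ≤ 1 / 2)
    (hv : 1 / 2 ≤ iwV M) (hR : iwV M ≤ R) (i j : Fin 2) : |M.1 i j| ≤ Real.sqrt (2 + R) := by
  have hv0 := iwV_pos M
  have htop : M.1 0 0 ^ 2 + M.1 0 1 ^ 2 ≤ 2 + R := by
    rw [sq_topRow_eq, div_le_iff₀ hv0, ← sq_abs (iwU M)]
    nlinarith [abs_nonneg (iwU M)]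
  have hbot : M.1 1 0 ^ 2 + M.1 1 1 ^ 2 ≤ 2 + R := by
    rw [← inv_iwV]
    have : (iwV M)⁻¹ ≤ 2 := inv_le_of_inv_le₀ two_pos (by linarith)
    linarith
  apply Real.abs_le_sqrt
  fin_cases i <;> fin_cases j
  · exact (le_add_of_nonneg_right (sq_nonneg _)).trans htop
  · exact (le_add_of_nonneg_left (sq_nonneg _)).trans htop
  · exact (le_add_of_nonneg_right (sq_nonneg _)).trans hbot
  · exact (le_add_of_nonneg_left (sq_nonneg _)).trans hbot

/-! ### The laws as a function on the modular quotient -/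

theorem toQuot_mul_of_mem {γ : SL(2, ℝ)} (hγ : γ ∈ Gam) (M : SL(2, ℝ)) :
    toQuot (γ * M) = toQuot M := by
  refine Quotient.sound (QuotientGroup.rightRel_apply.mpr ?_)
  rw [mul_inv_rev, mul_inv_cancel_left]
  exact inv_mem hγ

/-- `ν_M` as a function of the coset of `M`. -/
def nuQ : ModQuot → ProbabilityMeasure ℂ :=
  Quotient.lift nuG fun M N h => by
    rw [← nuG_mul_of_mem (QuotientGroup.rightRel_apply.mp h) M, inv_mul_cancel_right]

theorem nuQ_toQuot (M : SL(2, ℝ)) : nuQ (toQuot M) = nuG M := rfl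

theorem continuous_nuQ : Continuous nuQ := continuous_nuG.quotient_lift _

theorem tendsto_nuQ_cocompact : Tendsto nuQ (cocompact ModQuot) (𝓝 delta0) := by
  intro W hW
  obtain ⟨s, hs, hsW⟩ := mem_comap.mp (tendsto_nuG_cusp hW)
  obtain ⟨R, hR⟩ := mem_atTop_sets.mp hs
  refine mem_cocompact.mpr ⟨toQuot '' {M | ∀ i j, |M.1 i j| ≤ Real.sqrt (2 + R)},
    (isCompact_setOf_abs_entry_le _).image continuous_quotient_mk', fun q hq => ?_⟩
  obtain ⟨M, rfl⟩ := Quotient.exists_rep q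
  obtain ⟨γ, hγ, hu, hv⟩ := exists_mem_Gam_mul_reduced M
  change toQuot M ∈ _ at hq ⊢
  rw [← toQuot_mul_of_mem hγ] at hq ⊢
  rcases le_total (iwV (γ * M)) R with h | h
  · exact absurd ⟨_, abs_entry_le_of_reduced hu hv h, rfl⟩ hq
  · exact hsW (hR _ h)

theorem closure_range_nuQ : closure (Set.range nuQ) = Set.range nuQ ∪ {delta0} := by
  refine (closure_minimal Set.subset_union_left ?_).antisymm
    (Set.union_subset subset_closure (Set.singleton_subset_iff.mpr ?_))
  · rw [Set.union_singleton]
    exact (tendsto_nuQ_cocompact.isCompact_insert_range_of_cocompact continuous_nuQ).isClosed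
  · exact mem_closure_of_tendsto tendsto_nuG_cusp (.of_forall fun M => ⟨toQuot M, nuQ_toQuot M⟩)

theorem summable_thetaTermLp (M : SL(2, ℝ)) : Summable (thetaTermLp M) := by
  rw [funext (thetaTermLp_eq_zakTermₗ M)]
  exact summable_zakTermₗ _

end ThetaLaw
end

theorem mainTheorem4 :
    -- the theta series of the indicator function of `(0,1]` converges in `L²(𝕋²)`
    (∀ M : SL(2, ℝ), Summable (ThetaLaw.thetaTermLp M)) ∧
    -- `ν_M` depends only on the class of `M` in `Γ \ G`
    ∃ ν : ThetaLaw.ModQuot → ProbabilityMeasure ℂ,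
      (∀ M : SL(2, ℝ), ν (ThetaLaw.toQuot M) = ThetaLaw.nuG M) ∧
      closure (Set.range ν) = Set.range ν ∪ {ThetaLaw.delta0} ∧
      ∀ M : ℕ → ThetaLaw.ModQuot,
        (∀ K : Set ThetaLaw.ModQuot, IsCompact K → ∃ i₀ : ℕ, ∀ i ≥ i₀, M i ∉ K) →
          Tendsto (fun i => ν (M i)) atTop (𝓝 ThetaLaw.delta0) := by
  refine ⟨ThetaLaw.summable_thetaTermLp, ThetaLaw.nuQ, ThetaLaw.nuQ_toQuot,
    ThetaLaw.closure_range_nuQ, fun M hM => ThetaLaw.tendsto_nuQ_cocompact.comp ?_⟩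
  exact hasBasis_cocompact.tendsto_right_iff.mpr fun K hK => eventually_atTop.mpr (hM K hK)
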